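/- **Theorem.** For a metric measure space $(X,d,\mu)$, write $B(x,r)$ for the open ball and $S(x,r)=B(x,r+1)\smallsetminus B(x,r)$ for the sphere of centre $x$ and radius $r$. Say that the volume of spheres of $X$ is *dominated* by $r^{\alpha}$ if there are constants $C,R$ such that $\mu(S(x,r))\le C\,r^{\alpha}$ for all $x\in X$ and all $r\ge R$. 1. There is a connected graph of bounded degree which, with its path metric on the vertex set, is quasi-isometric to $\mathbf{Z}^2$ (with the metric of its standard Cayley graph), and whose volume of spheres, for the counting measure on the vertices, is not dominated by $r^{\log 3/\log 2}$. 2. There is a smooth Riemannian manifold $M$, bi-Lipschitz equivalent to the Euclidean plane $\mathbf{R}^2$, whose volume of spheres, for the Riemannian distance and the Riemannian measure, is not dominated by $r^{\log 3/\log 2}$. Equivalently, in both cases: for all constants $C,R$ there are a point $x$ and a radius $r\ge R$ with $\mu(S(x,r))> C\,r^{\log 3/\log 2}$. -/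

import Mathlib

open scoped Manifold ContDiff Bundle ENNReal

noncomputable section

/-- The (open) ball of centre `x` and radius `r` for the distance function `d`. -/
def openBall {X : Type*} (d : X → X → ℝ) (x : X) (r : ℝ) : Set X :=
  {y | d x y < r}

/-- The sphere `S(x, r) = B(x, r + 1) \ B(x, r)` of centre `x` and radius `r`. -/
def thickSphere {X : Type*} (d : X → X → ℝ) (x : X) (r : ℝ) : Set X :=
  openBall d x (r + 1) \ openBall d x r

/-- The volume of spheres is dominated by `g`: up to a multiplicative constant, all spheres of
sufficiently large radius `r` have volume at most `g r`, uniformly in the centre. -/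
def SpheresDominatedBy {X : Type*} (d : X → X → ℝ) (vol : Set X → ℝ≥0∞) (g : ℝ → ℝ) : Prop :=
  ∃ C R : ℝ, ∀ (x : X) (r : ℝ), R ≤ r → vol (thickSphere d x r) ≤ ENNReal.ofReal (C * g r)

/-- `f` is a quasi-isometry from `(X, dX)` to `(Y, dY)`. -/
def IsQuasiIsometry {X Y : Type*} (dX : X → X → ℝ) (dY : Y → Y → ℝ) (f : X → Y) : Prop :=
  (∃ C₁ : ℝ, 0 < C₁ ∧ ∀ y : Y, ∃ x : X, dY y (f x) ≤ C₁) ∧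
  (∃ C₂ : ℝ, 1 ≤ C₂ ∧ ∀ x y : X,
    C₂⁻¹ * dX x y - C₂ ≤ dY (f x) (f y) ∧ dY (f x) (f y) ≤ C₂ * dX x y + C₂)

/-- The path distance of a (connected) graph, as a real number. -/
def graphDist {V : Type*} (G : SimpleGraph V) (v w : V) : ℝ := (G.dist v w : ℝ)

/-- The counting measure of a set of vertices. -/
def countingVolume {V : Type*} (S : Set V) : ℝ≥0∞ := (S.encard : ℝ≥0∞)

/-- All vertices have at most `D` neighbours, for some `D`. -/
def HasBoundedDegree {V : Type*} (G : SimpleGraph V) : Prop :=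
  ∃ D : ℕ, ∀ v : V, (G.neighborSet v).encard ≤ D

/-- The standard Cayley graph of `ℤ²`. -/
def gridGraph : SimpleGraph (ℤ × ℤ) := SimpleGraph.addCayley {((1 : ℤ), (0 : ℤ)), (0, 1)}

section Riemannian

attribute [local instance 2000] chartedSpaceSelf

variable {n : ℕ} {M : Type*} [TopologicalSpace M] [ChartedSpace (EuclideanSpace ℝ (Fin n)) M]
  [Bundle.RiemannianBundle (fun x : M => TangentSpace (𝓡 n) x)]

/-- The matrix `g_{ij} = ⟪∂_i, ∂_j⟫` of the Riemannian metric in the chart `e`, at the point `y`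
of the target of `e`; here `∂_i` is the image of the `i`-th standard basis vector under the
derivative of the parametrization `e.symm`. -/
def metricMatrix (e : OpenPartialHomeomorph M (EuclideanSpace ℝ (Fin n)))
    (y : EuclideanSpace ℝ (Fin n)) : Matrix (Fin n) (Fin n) ℝ :=
  Matrix.of fun i j =>
    inner ℝ (mfderiv (𝓡 n) (𝓡 n) e.symm y (EuclideanSpace.single i (1 : ℝ)))
      (mfderiv (𝓡 n) (𝓡 n) e.symm y (EuclideanSpace.single j (1 : ℝ)))

/-- `μ` is the Riemannian measure of `M`: in each chart of the atlas it is given by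
`√(det g_{ij}) dy`. -/
def IsRiemannianMeasure [MeasurableSpace M] (μ : MeasureTheory.Measure M) : Prop :=
  ∀ e ∈ atlas (EuclideanSpace ℝ (Fin n)) M, ∀ s : Set M, MeasurableSet s → s ⊆ e.source →
    μ s = ∫⁻ y in e '' s, ENNReal.ofReal (Real.sqrt (metricMatrix (n := n) e y).det)

end Riemannian

/-- A bi-Lipschitz equivalence: a bijection distorting distances by at most a constant factor. -/
def IsBiLipschitz {X Y : Type*} [MetricSpace X] [MetricSpace Y] (f : X → Y) : Prop :=
  Function.Bijective f ∧ ∃ K : ℝ, 1 ≤ K ∧ ∀ x y : X,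
    K⁻¹ * dist x y ≤ dist (f x) (f y) ∧ dist (f x) (f y) ≤ K * dist x y

end

/-! Draw binary H-trees in the plane and make their arms fast. A tree of level `j + 1` is an arm
issuing from the origin, with two trees of level `j` attached there at right angles, so a tree of
level `j` has `2 ^ j` leaves. Along the arms a conformal factor `ρ` drops from 1 to 1/256. Arm
lengths grow by 9/4 every two levels, that is by about 3/2 per level. This exceeds the rate √2
needed to fit the trees in the plane without crowding, while the travel time `T` from leaf to root
is only of order (3/2)^j. Hence there are about `T ^ (log 2 / log (3/2))` leaves, all nearly
equidistant from the root, and this exponent is larger than log 3 / log 2.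

The distance from leaf to root is bounded above by following the arms, with a loss of at most 2 per
level (`leaf_root_le`). The lower bound is a calibration. The time function `treeFun` is 0 at the
leaves and the total time at the root, and it is 1-Lipschitz for the conformal metric
(`exists_conformal_factor`), so no shortcut exists (`le_conformalEDist`, `le_dist_leaf_root`). The
delicate point is that inside each tube the slope must be at most 1/256, which requires every other
arm to be irrelevant there (`armFun_succ_le_treeFun`).

In a tree of level `2 * m` the `4 ^ m` leaves thus lie in a shell of thickness O(m) around the root.
By pigeonhole (`exists_window`) a sphere of thickness 1 contains at least a fraction 1/O(m) of them,
and this loss is absorbed by the strict inequality of exponents (`eventually_rpow_mul_lt`). Trees of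
all levels are placed side by side in one plane. Since 1/256 ≤ ρ ≤ 1, the metric is bi-Lipschitz to
the Euclidean one. The graph is the discretization of the same distance on the integer points. -/

open MeasureTheory Set Filter Topology

noncomputable section

/-! ### Conformal metrics on the plane: distance and measure. -/

section ConformalPlane

attribute [local instance 2000] chartedSpaceSelf

/-- The Euclidean plane. -/
abbrev Plane : Type := EuclideanSpace ℝ (Fin 2)

set_option synthInstance.maxHeartbeats 400000 in
set_option maxHeartbeats 1000000 in
/-- The conformal Riemannian metric `ρ² |dx|²` on the plane. -/
def conformalMetric (ρ : Plane → ℝ) (hρ : ContDiff ℝ ∞ ρ) (hpos : ∀ x, 0 < ρ x) :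
    Bundle.ContMDiffRiemannianMetric (𝓡 2) ∞ Plane (fun x : Plane => TangentSpace (𝓡 2) x) where
  inner x := (ρ x) ^ 2 • (riemannianMetricVectorSpace Plane).inner x
  symm x v w := by
    change (ρ x) ^ 2 * inner ℝ (v : Plane) (w : Plane) = (ρ x) ^ 2 * inner ℝ (w : Plane) (v : Plane)
    rw [real_inner_comm]
  pos x v hv := by
    change 0 < (ρ x) ^ 2 * inner ℝ (v : Plane) (v : Plane)
    exact mul_pos (pow_pos (hpos x) 2) (real_inner_self_pos.2 hv)
  isVonNBounded x := by
    change Bornology.IsVonNBounded ℝ {v : Plane | (ρ x) ^ 2 * inner ℝ v v < 1}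
    refine (NormedSpace.isVonNBounded_ball ℝ Plane (ρ x)⁻¹).subset fun v hv => ?_
    rw [mem_ball_zero_iff, ← one_div, lt_div_iff₀ (hpos x)]
    simp only [mem_ofPred_eq, real_inner_self_eq_norm_sq] at hv
    nlinarith [mul_nonneg (norm_nonneg v) (hpos x).le]
  contMDiff := by
    have h1 : ContMDiff (𝓡 2) 𝓘(ℝ, ℝ) ∞ fun x : Plane => (ρ x) ^ 2 := (hρ.pow 2).contMDiff
    exact h1.smul_section ((riemannianMetricVectorSpace Plane).contMDiff.of_le le_top)

section
variable (ρ : Plane → ℝ) (hρ : ContDiff ℝ ∞ ρ) (hpos : ∀ x, 0 < ρ x)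

/-- The conformal metric as a Riemannian structure on the tangent bundle of the plane. -/
@[reducible] def conformalBundle : Bundle.RiemannianBundle (fun x : Plane => TangentSpace (𝓡 2) x) :=
  ⟨(conformalMetric ρ hρ hpos).toRiemannianMetric⟩

theorem conformal_inner (x : Plane) (v w : TangentSpace (𝓡 2) x) :
    letI := conformalBundle ρ hρ hpos
    inner ℝ v w = (ρ x) ^ 2 * inner ℝ (show Plane from v) (show Plane from w) := rfl

theorem conformal_norm (x : Plane) (v : TangentSpace (𝓡 2) x) :
    letI := conformalBundle ρ hρ hpos
    ‖v‖ = ρ x * ‖(show Plane from v)‖ := by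
  let _ := conformalBundle ρ hρ hpos
  rw [norm_eq_sqrt_real_inner, conformal_inner, real_inner_self_eq_norm_sq, ← mul_pow,
    Real.sqrt_sq (mul_nonneg (hpos x).le (norm_nonneg _))]

theorem conformal_enorm (x : Plane) (v : TangentSpace (𝓡 2) x) :
    letI := conformalBundle ρ hρ hpos
    ‖v‖ₑ = ENNReal.ofReal (ρ x * ‖(show Plane from v)‖) := by
  let _ := conformalBundle ρ hρ hpos
  rw [← ofReal_norm, conformal_norm]

/-- The Riemannian distance of the conformal metric. -/
def conformalEDist (x y : Plane) : ℝ≥0∞ :=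
  let _ := conformalBundle ρ hρ hpos
  Manifold.riemannianEDist (𝓡 2) x y

theorem conformalEDist_le_of_segment {x y : Plane} {b : ℝ}
    (h : ∀ t ∈ Icc (0 : ℝ) 1, ρ (x + t • (y - x)) ≤ b) :
    conformalEDist ρ hρ hpos x y ≤ ENNReal.ofReal (b * ‖y - x‖) := by
  let _ := conformalBundle ρ hρ hpos
  set γ : ℝ → Plane := fun t => x + t • (y - x) with hγ
  have hγs : ContDiff ℝ 1 γ := by fun_prop
  have hd : ∀ t, HasDerivAt γ (y - x) t := fun t => by
    simpa [hγ] using ((hasDerivAt_id t).smul_const (y - x)).const_add x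
  have : conformalEDist ρ hρ hpos x y ≤ Manifold.pathELength (𝓡 2) γ 0 1 := by
    apply Manifold.riemannianEDist_le_pathELength ?_ (by simp [γ]) (by simp [γ]) zero_le_one
    exact (contMDiff_iff_contDiff.2 hγs).contMDiffOn
  refine this.trans ?_
  rw [Manifold.pathELength_eq_lintegral_mfderiv_Icc]
  calc _ ≤ ∫⁻ t in Icc (0 : ℝ) 1, ENNReal.ofReal (b * ‖y - x‖) := by
        apply setLIntegral_mono' measurableSet_Icc fun t ht => ?_
        rw [conformal_enorm]
        apply ENNReal.ofReal_le_ofReal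
        have : (show Plane from (mfderiv 𝓘(ℝ, ℝ) (𝓡 2) γ t) (1 : ℝ)) = y - x := by
          rw [mfderiv_eq_fderiv, (hd t).hasFDerivAt.fderiv]
          exact one_smul ℝ (y - x)
        erw [this]
        exact mul_le_mul_of_nonneg_right (h t ht) (norm_nonneg _)
    _ = _ := by simp

/-- Calibration: along any path `v` increases no faster than arc length. The hypothesis is a
pointwise slope bound instead of a gradient bound, because the time functions have kinks. -/
theorem le_conformalEDist {v : Plane → ℝ}
    (hv : ∀ p, ∀ᶠ q in 𝓝 p, |v q - v p| ≤ ρ p * ‖q - p‖) (x y : Plane) :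
    ENNReal.ofReal (v y - v x) ≤ conformalEDist ρ hρ hpos x y := by
  let _ := conformalBundle ρ hρ hpos
  apply le_of_forall_gt fun r hr => ?_
  obtain ⟨γ, h0, h1, hs, hl, -⟩ :=
    Manifold.exists_lt_locally_constant_of_riemannianEDist_lt hr zero_lt_one
  refine lt_of_le_of_lt ?_ hl
  have hγ : ContDiff ℝ 1 γ := contMDiff_iff_contDiff.1 hs
  have hγd : ∀ t, HasDerivAt γ (deriv γ t) t := fun t =>
    (hγ.differentiable one_ne_zero t).hasDerivAt
  set b : ℝ → ℝ := fun t => ρ (γ t) * ‖deriv γ t‖ with hb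
  have hbc : Continuous b :=
    (hρ.continuous.comp hγ.continuous).mul (hγ.continuous_deriv le_rfl).norm
  have hb0 : ∀ t, 0 ≤ b t := fun t => mul_nonneg (hpos _).le (norm_nonneg _)
  have hlen : Manifold.pathELength (𝓡 2) γ 0 1 = ENNReal.ofReal (∫ t in (0 : ℝ)..1, b t) := by
    rw [Manifold.pathELength_eq_lintegral_mfderiv_Icc,
      intervalIntegral.integral_of_le zero_le_one, ← integral_Icc_eq_integral_Ioc,
      ofReal_integral_eq_lintegral_ofReal (hbc.integrableOn_Icc)
        (Eventually.of_forall hb0)]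
    congr 1
    ext t
    rw [conformal_enorm]
    congr 3
    change (mfderiv 𝓘(ℝ, ℝ) (𝓡 2) γ t) (1 : ℝ) = _
    rw [mfderiv_eq_fderiv]
    exact fderiv_apply_one_eq_deriv
  rw [hlen]
  apply ENNReal.ofReal_le_ofReal
  have hB : ∀ t, HasDerivAt (fun s => v (γ 0) + ∫ u in (0 : ℝ)..s, b u) (b t) t := fun t =>
    (intervalIntegral.integral_hasDerivAt_right (hbc.intervalIntegrable _ _)
      (hbc.stronglyMeasurableAtFilter _ _) hbc.continuousAt).const_add _
  have hvc : Continuous v := by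
    rw [continuous_iff_continuousAt]
    intro p
    rw [ContinuousAt, tendsto_iff_norm_sub_tendsto_zero]
    refine squeeze_zero' (Eventually.of_forall fun _ => norm_nonneg _) (hv p) ?_
    have : Continuous fun q : Plane => ρ p * ‖q - p‖ := by fun_prop
    simpa using this.tendsto p
  have key : ∀ ⦃t⦄, t ∈ Icc (0 : ℝ) 1 → (v ∘ γ) t ≤ v (γ 0) + ∫ u in (0 : ℝ)..t, b u := by
    -- As `v ∘ γ` need not be differentiable, its right slopes are compared with the derivative of
    -- the length.
    refine image_le_of_liminf_slope_right_le_deriv_boundary (f := v ∘ γ) (B' := b)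
      (hvc.comp hγ.continuous).continuousOn (by simp)
      (fun t _ => (hB t).continuousAt.continuousWithinAt)
      (fun t _ => (hB t).hasDerivWithinAt) ?_
    intro t _ r hr
    apply Eventually.frequently
    have h1 : Tendsto (fun z => ρ (γ t) * ‖slope γ t z‖) (𝓝[>] t) (𝓝 (b t)) :=
      ((hasDerivAt_iff_tendsto_slope.1 (hγd t)).mono_left
        (nhdsWithin_mono _ fun z hz => ne_of_gt hz)).norm.const_mul _
    have h2 : ∀ᶠ z in 𝓝[>] t, |v (γ z) - v (γ t)| ≤ ρ (γ t) * ‖γ z - γ t‖ :=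
      (hγ.continuous.continuousAt.eventually (hv (γ t))).filter_mono nhdsWithin_le_nhds
    filter_upwards [h1.eventually (gt_mem_nhds hr), h2, self_mem_nhdsWithin] with z hz hz2 hz3
    refine lt_of_le_of_lt ?_ hz
    have hz4 : 0 < z - t := sub_pos.2 hz3
    rw [slope_def_field, slope_def_module, norm_smul, norm_inv, Real.norm_eq_abs, abs_of_pos hz4,
      div_le_iff₀ hz4]
    calc _ ≤ ρ (γ t) * ‖γ z - γ t‖ := (le_abs_self _).trans hz2
      _ = _ := by field_simp
  have := key (right_mem_Icc.2 zero_le_one)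
  simp only [Function.comp_apply, h0, h1] at this
  linarith

end

section
variable (ρ : Plane → ℝ) (hρ : ContDiff ℝ ∞ ρ) (hpos : ∀ x, 0 < ρ x)

theorem conformalEDist_le_edist (h1 : ∀ x, ρ x ≤ 1) (x y : Plane) :
    conformalEDist ρ hρ hpos x y ≤ ENNReal.ofReal ‖y - x‖ := by
  simpa using conformalEDist_le_of_segment ρ hρ hpos (b := 1) (x := x) (y := y) fun t _ => h1 _

theorem isContinuousRiemannianBundle_conformal :
    letI := conformalBundle ρ hρ hpos
    IsContinuousRiemannianBundle Plane (fun x : Plane => TangentSpace (𝓡 2) x) :=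
  letI := conformalBundle ρ hρ hpos
  ⟨(conformalMetric ρ hρ hpos).inner, (conformalMetric ρ hρ hpos).contMDiff.continuous,
    fun _ _ _ => rfl⟩

/-- The plane as a metric space, for the Riemannian distance of a bounded conformal metric. -/
@[reducible] def conformalMetricSpace (h1 : ∀ x, ρ x ≤ 1) : MetricSpace Plane :=
  letI := conformalBundle ρ hρ hpos
  haveI := isContinuousRiemannianBundle_conformal ρ hρ hpos
  letI : EMetricSpace Plane := EMetricSpace.ofRiemannianMetric (𝓡 2) Plane
  EMetricSpace.toMetricSpace fun x y =>
    ((conformalEDist_le_edist ρ hρ hpos h1 x y).trans_lt ENNReal.ofReal_lt_top).ne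

theorem isContMDiffRiemannianBundle_conformal :
    letI := conformalBundle ρ hρ hpos
    IsContMDiffRiemannianBundle (𝓡 2) ∞ Plane (fun x : Plane => TangentSpace (𝓡 2) x) :=
  letI := conformalBundle ρ hρ hpos
  ⟨(conformalMetric ρ hρ hpos).inner, (conformalMetric ρ hρ hpos).contMDiff, fun _ _ _ => rfl⟩

theorem isRiemannianManifold_conformal (h1 : ∀ x, ρ x ≤ 1) :
    @IsRiemannianManifold _ _ _ _ _ (𝓡 2) Plane _
      (conformalMetricSpace ρ hρ hpos h1).toEMetricSpace.toPseudoEMetricSpace _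
      (conformalBundle ρ hρ hpos) :=
  @IsRiemannianManifold.mk _ _ _ _ _ (𝓡 2) Plane _
    (conformalMetricSpace ρ hρ hpos h1).toEMetricSpace.toPseudoEMetricSpace _
    (conformalBundle ρ hρ hpos) fun _ _ => rfl

/-- The Riemannian measure `ρ² dx` of the conformal metric. -/
def conformalMeasure : Measure Plane := volume.withDensity fun x => ENNReal.ofReal ((ρ x) ^ 2)

/-- The only chart is the identity, where the metric matrix is ρ² times the identity; in dimension 2
the root of its determinant is ρ². -/
theorem isRiemannianMeasure_conformalMeasure :
    letI := conformalBundle ρ hρ hpos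
    IsRiemannianMeasure (n := 2) (M := Plane) (conformalMeasure ρ) := by
  let _ := conformalBundle ρ hρ hpos
  intro e he s hs _
  obtain rfl : e = OpenPartialHomeomorph.refl _ := he
  have himg : (OpenPartialHomeomorph.refl Plane) '' s = s := by simp
  rw [himg, conformalMeasure, withDensity_apply _ hs]
  congr 1
  ext y
  congr 1
  have hm : metricMatrix (n := 2) (M := Plane) (OpenPartialHomeomorph.refl _) y
      = Matrix.diagonal fun _ => (ρ y) ^ 2 := by
    ext i j
    rw [metricMatrix, Matrix.of_apply]
    have hd : mfderiv (𝓡 2) (𝓡 2) (OpenPartialHomeomorph.refl Plane).symm y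
        = ContinuousLinearMap.id ℝ _ := mfderiv_id
    rw [hd]
    refine (conformal_inner ρ hρ hpos y _ _).trans ?_
    change (ρ y) ^ 2 * inner ℝ (EuclideanSpace.single i (1 : ℝ)) (EuclideanSpace.single j (1 : ℝ)) = _
    rw [EuclideanSpace.inner_single_left]
    by_cases hij : i = j
    · subst hij; simp
    · simp [hij]
  rw [hm, Matrix.det_diagonal]
  simp [Real.sqrt_sq (sq_nonneg (ρ y))]

end

/-- A conformal metric `ρ² |dx|²` with `c ≤ ρ ≤ 1`: properties of its Riemannian distance `d`, and
existence of the corresponding Riemannian manifold. -/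
theorem exists_conformal_plane (ρ : Plane → ℝ) (hρ : ContDiff ℝ ∞ ρ) {c : ℝ} (hc : 0 < c)
    (hcρ : ∀ x, c ≤ ρ x) (h1 : ∀ x, ρ x ≤ 1) :
    ∃ d : Plane → Plane → ℝ,
      (∀ x y, c * ‖y - x‖ ≤ d x y) ∧ (∀ x y, d x y ≤ ‖y - x‖) ∧
      (∀ x y, d x y = d y x) ∧ (∀ x y z, d x z ≤ d x y + d y z) ∧
      (∀ v : Plane → ℝ, (∀ p, ∀ᶠ q in 𝓝 p, |v q - v p| ≤ ρ p * ‖q - p‖) →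
        ∀ x y, v y - v x ≤ d x y) ∧
      (∀ (x y : Plane) (b : ℝ), 0 ≤ b → (∀ t ∈ Icc (0 : ℝ) 1, ρ (x + t • (y - x)) ≤ b) →
        d x y ≤ b * ‖y - x‖) ∧
      ∃ (M : Type) (_ : MetricSpace M) (_ : MeasurableSpace M) (_ : BorelSpace M)
        (_ : ChartedSpace (EuclideanSpace ℝ (Fin 2)) M) (_ : IsManifold (𝓡 2) ∞ M)
        (_ : Bundle.RiemannianBundle (fun x : M => TangentSpace (𝓡 2) x))
        (_ : IsContMDiffRiemannianBundle (𝓡 2) ∞ (EuclideanSpace ℝ (Fin 2))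
          (fun x : M => TangentSpace (𝓡 2) x))
        (_ : IsRiemannianManifold (𝓡 2) M) (μ : MeasureTheory.Measure M) (φ : M ≃ Plane),
        IsRiemannianMeasure (n := 2) μ ∧ (∀ x y, dist x y = d (φ x) (φ y)) ∧
        ∀ s : Set Plane, MeasurableSet s → ENNReal.ofReal (c ^ 2) * volume s ≤ μ (φ ⁻¹' s) := by
  have hpos : ∀ x, 0 < ρ x := fun x => hc.trans_le (hcρ x)
  have hfin : ∀ x y, conformalEDist ρ hρ hpos x y ≠ ⊤ := fun x y =>
    ((conformalEDist_le_edist ρ hρ hpos h1 x y).trans_lt ENNReal.ofReal_lt_top).ne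
  have hlow : ∀ v : Plane → ℝ, (∀ p, ∀ᶠ q in 𝓝 p, |v q - v p| ≤ ρ p * ‖q - p‖) →
      ∀ x y, v y - v x ≤ (conformalEDist ρ hρ hpos x y).toReal := fun v hv x y =>
    (ENNReal.ofReal_le_iff_le_toReal (hfin x y)).1 (le_conformalEDist ρ hρ hpos hv x y)
  have hup : ∀ (x y : Plane) (b : ℝ), 0 ≤ b →
      (∀ t ∈ Icc (0 : ℝ) 1, ρ (x + t • (y - x)) ≤ b) →
      (conformalEDist ρ hρ hpos x y).toReal ≤ b * ‖y - x‖ := fun x y b hb h =>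
    ENNReal.toReal_le_of_le_ofReal (mul_nonneg hb (norm_nonneg _))
      (conformalEDist_le_of_segment ρ hρ hpos h)
  refine ⟨fun x y => (conformalEDist ρ hρ hpos x y).toReal, fun x y => ?_, fun x y => ?_,
    fun x y => ?_, fun x y z => ?_, hlow, hup, ?_⟩
  -- The Euclidean lower bound is itself a calibration, by the scaled distance to `x`.
  · have := hlow (fun p => c * ‖p - x‖) (fun p => Eventually.of_forall fun q => ?_) x y
    · simpa using this
    · rw [← mul_sub, abs_mul, abs_of_pos hc]
      refine mul_le_mul (hcρ p) ((abs_norm_sub_norm_le _ _).trans_eq ?_) (abs_nonneg _) (hpos p).le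
      congr 1; abel
  · simpa using hup x y 1 zero_le_one fun t _ => h1 _
  · let _ := conformalBundle ρ hρ hpos
    exact congrArg ENNReal.toReal Manifold.riemannianEDist_comm
  · let _ := conformalBundle ρ hρ hpos
    rw [← ENNReal.toReal_add (hfin _ _) (hfin _ _)]
    exact ENNReal.toReal_mono (ENNReal.add_ne_top.2 ⟨hfin _ _, hfin _ _⟩)
      Manifold.riemannianEDist_triangle
  · refine ⟨Plane, conformalMetricSpace ρ hρ hpos h1, inferInstanceAs (MeasurableSpace Plane),
      inferInstanceAs (BorelSpace Plane), chartedSpaceSelf _, inferInstanceAs (IsManifold (𝓡 2) ∞ Plane),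
      conformalBundle ρ hρ hpos, ?_, ?_, conformalMeasure ρ, Equiv.refl _,
      isRiemannianMeasure_conformalMeasure ρ hρ hpos, fun x y => rfl, fun s hs => ?_⟩
    · exact isContMDiffRiemannianBundle_conformal ρ hρ hpos
    · exact isRiemannianManifold_conformal ρ hρ hpos h1
    · change _ ≤ conformalMeasure ρ s
      rw [conformalMeasure, withDensity_apply _ hs, ← setLIntegral_const]
      exact lintegral_mono fun x => ENNReal.ofReal_le_ofReal
        (pow_le_pow_left₀ hc.le (hcρ x) 2)

end ConformalPlane

/-! ### Numerology of arm lengths and travel times. -/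

/-- Integers growing like `(9/4)^i`. -/
def growth : ℕ → ℕ
  | 0 => 8
  | i + 1 => 9 * growth i / 4

/-- The time needed to run through the arm of level `j`. -/
def armTime (j : ℕ) : ℕ := growth (j / 2)

/-- The length of the arm of level `j`. -/
def armLength (j : ℕ) : ℝ := 256 * armTime j

/-- The time needed to run through the arms of levels `< j`. -/
def totalTime (j : ℕ) : ℝ := ∑ i ∈ Finset.range j, (armTime i : ℝ)

theorem eight_le_growth (i : ℕ) : 8 ≤ growth i := by
  induction i with
  | zero => simp [growth]
  | succ i ih => simp only [growth]; omega

theorem growth_le_pow (i : ℕ) : (growth i : ℝ) ≤ 8 * (9 / 4 : ℝ) ^ i := by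
  induction i with
  | zero => simp [growth]
  | succ i ih =>
    have h : 4 * growth (i + 1) ≤ 9 * growth i := by simp only [growth]; omega
    have h' : (4 : ℝ) * growth (i + 1) ≤ 9 * growth i := by exact_mod_cast h
    rw [pow_succ]
    linarith

theorem eight_le_armTime (j : ℕ) : (8 : ℝ) ≤ armTime j := by
  exact_mod_cast eight_le_growth _

theorem armTime_le_succ (j : ℕ) : (armTime j : ℝ) ≤ armTime (j + 1) := by
  have : armTime j ≤ armTime (j + 1) := by
    unfold armTime
    rcases Nat.even_or_odd' j with ⟨i, rfl | rfl⟩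
    · rw [show (2 * i + 1) / 2 = 2 * i / 2 by omega]
    · rw [show (2 * i + 1 + 1) / 2 = (2 * i + 1) / 2 + 1 by omega]
      have := eight_le_growth ((2 * i + 1) / 2)
      simp only [growth]; omega
  exact_mod_cast this

theorem armTime_add_two (j : ℕ) : (4 : ℝ) * armTime (j + 2) ≤ 9 * armTime j ∧
    (9 : ℝ) * armTime j ≤ 4 * armTime (j + 2) + 3 := by
  have : 4 * armTime (j + 2) ≤ 9 * armTime j ∧ 9 * armTime j ≤ 4 * armTime (j + 2) + 3 := by
    unfold armTime
    rw [show (j + 2) / 2 = j / 2 + 1 by omega]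
    simp only [growth]; omega
  exact_mod_cast this

theorem totalTime_succ (j : ℕ) : totalTime (j + 1) = totalTime j + armTime j :=
  Finset.sum_range_succ _ _

theorem totalTime_nonneg (j : ℕ) : 0 ≤ totalTime j := Finset.sum_nonneg fun _ _ => Nat.cast_nonneg _

theorem armLength_eq (j : ℕ) : armLength j = 256 * armTime j := rfl

theorem le_armLength (j : ℕ) : 2048 ≤ armLength j := by
  rw [armLength_eq]; linarith [eight_le_armTime j]

/-- Geometric growth over two levels makes the sum comparable to its last term; the rounding error
is absorbed by `eight_le_armTime`. -/
theorem totalTime_succ_le (j : ℕ) : totalTime (j + 1) ≤ 4 * armTime j := by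
  induction j using Nat.twoStepInduction with
  | zero => simp [totalTime, armTime, growth]
  | one => simp [totalTime, armTime, growth, Finset.sum_range_succ]; norm_num
  | more j ih _ =>
    rw [totalTime_succ, totalTime_succ]
    linarith [armTime_le_succ (j + 1), armTime_add_two j, eight_le_armTime j]

theorem le_totalTime (j : ℕ) : (j : ℝ) ≤ totalTime j := by
  induction j with
  | zero => simp [totalTime]
  | succ j ih => rw [totalTime_succ]; push_cast; linarith [eight_le_armTime j]

/-- A bound for the half-width of the tree of level `j`. -/
def halfWidth : ℕ → ℝ
  | 0 => 1
  | j + 1 => 2 * armLength j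

/-- This is what leaves room for the subtrees. It rests on 9/4 > 2, on the speed 256, which makes
times small against lengths, and on the initial value 8, which pays for the rounding. -/
theorem halfWidth_le (j : ℕ) : halfWidth j + 1 + 2 * totalTime (j + 3) ≤ armLength (j + 1) := by
  have h1 := totalTime_succ_le (j + 2)
  have h2 := (armTime_add_two (j + 1)).1
  have h3 := armTime_le_succ (j + 2)
  have h4 := eight_le_armTime (j + 1)
  cases j with
  | zero =>
    simp only [halfWidth, armLength_eq]
    linarith
  | succ j =>
    simp only [halfWidth, armLength_eq] at *
    have h5 := (armTime_add_two j).2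
    have h6 := eight_le_armTime j
    simp only [add_assoc, Nat.reduceAdd] at *
    linarith

theorem halfWidth_le_armLength (j : ℕ) : halfWidth j ≤ armLength (j + 1) := by
  linarith [halfWidth_le j, totalTime_nonneg (j + 3)]

/-! ### Trees by folding, and their time functions. -/

/-- The folding map from the tree of level `j + 1` onto its two subtrees of level `j`. -/
def fold (j : ℕ) (p : ℝ × ℝ) : ℝ × ℝ := (armLength j - |p.2|, p.1)

/-- The distance to the `1/4`-neighbourhood of the arm of level `j`. -/
def armDist (j : ℕ) (p : ℝ × ℝ) : ℝ :=
  max (max (|p.2| - 1 / 4) 0) (max (-(1 / 4) - p.1) (p.1 - armLength j - 1 / 4))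

/-- The time function in the vicinity of the arm of level `j`. -/
def armFun (j : ℕ) (p : ℝ × ℝ) : ℝ :=
  totalTime j + max 0 (min p.1 (armLength j)) / 256 - armDist j p / 2

/-- The time function of the tree of level `j`. -/
def treeFun : ℕ → ℝ × ℝ → ℝ
  | 0 => fun p => max 0 (armFun 0 p)
  | j + 1 => fun p => max (treeFun j (fold j p)) (armFun (j + 1) p)

/-- The tube around the arm of level `j`. -/
def armTube (j : ℕ) : Set (ℝ × ℝ) :=
  {p | |p.2| < 1 / 4 ∧ -(1 / 4) < p.1 ∧ p.1 < armLength j - 3 / 4}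

/-- The tubes around all arms of the tree of level `j`. -/
def treeTube : ℕ → Set (ℝ × ℝ)
  | 0 => armTube 0
  | j + 1 => armTube (j + 1) ∪ fold j ⁻¹' treeTube j

/-- The arm of level `j`. -/
def armCore (j : ℕ) : Set (ℝ × ℝ) := {p | p.2 = 0 ∧ 0 ≤ p.1 ∧ p.1 ≤ armLength j - 1}

/-- The arms of the tree of level `j`. -/
def treeCore : ℕ → Set (ℝ × ℝ)
  | 0 => armCore 0
  | j + 1 => armCore (j + 1) ∪ fold j ⁻¹' treeCore j

theorem continuous_fold (j : ℕ) : Continuous (fold j) := by unfold fold; fun_prop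

theorem dist_fold_le (j : ℕ) (p q : ℝ × ℝ) : dist (fold j p) (fold j q) ≤ dist p q := by
  simp only [fold, Prod.dist_eq, Real.dist_eq]
  rw [max_comm]
  refine max_le_max le_rfl ?_
  rw [show armLength j - |p.2| - (armLength j - |q.2|) = |q.2| - |p.2| by ring, abs_sub_comm p.2]
  exact abs_abs_sub_abs_le _ _

theorem isOpen_armTube (j : ℕ) : IsOpen (armTube j) := by
  have h1 : IsOpen {p : ℝ × ℝ | |p.2| < 1 / 4} := isOpen_lt (by fun_prop) (by fun_prop)
  have h2 : IsOpen {p : ℝ × ℝ | -(1 / 4) < p.1} := isOpen_lt (by fun_prop) (by fun_prop)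
  have h3 : IsOpen {p : ℝ × ℝ | p.1 < armLength j - 3 / 4} := isOpen_lt (by fun_prop) (by fun_prop)
  exact h1.inter (h2.inter h3)

theorem isOpen_treeTube (j : ℕ) : IsOpen (treeTube j) := by
  induction j with
  | zero => exact isOpen_armTube 0
  | succ j ih => exact (isOpen_armTube _).union (ih.preimage (continuous_fold j))

theorem isClosed_armCore (j : ℕ) : IsClosed (armCore j) := by
  have h1 : IsClosed {p : ℝ × ℝ | p.2 = 0} := isClosed_eq (by fun_prop) (by fun_prop)
  have h2 : IsClosed {p : ℝ × ℝ | 0 ≤ p.1} := isClosed_le (by fun_prop) (by fun_prop)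
  have h3 : IsClosed {p : ℝ × ℝ | p.1 ≤ armLength j - 1} := isClosed_le (by fun_prop) (by fun_prop)
  exact h1.inter (h2.inter h3)

theorem isClosed_treeCore (j : ℕ) : IsClosed (treeCore j) := by
  induction j with
  | zero => exact isClosed_armCore 0
  | succ j ih => exact (isClosed_armCore _).union (ih.preimage (continuous_fold j))

theorem treeCore_subset_treeTube (j : ℕ) : treeCore j ⊆ treeTube j := by
  have h : ∀ j, armCore j ⊆ armTube j := fun j p ⟨h1, h2, h3⟩ =>
    ⟨by rw [h1]; norm_num, by linarith, by linarith⟩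
  induction j with
  | zero => exact h 0
  | succ j ih => exact union_subset_union (h _) (preimage_mono ih)

theorem abs_clamp_sub_le (a x y : ℝ) : |max 0 (min x a) - max 0 (min y a)| ≤ |x - y| := by
  refine (abs_max_sub_max_le_max _ _ _ _).trans ?_
  refine max_le (by simp) ((abs_min_sub_min_le_max _ _ _ _).trans ?_)
  simp

theorem abs_armDist_sub_le (j : ℕ) (p q : ℝ × ℝ) : |armDist j p - armDist j q| ≤ dist p q := by
  have h1 : |p.1 - q.1| ≤ dist p q := le_max_left _ _
  have h2 : |p.2 - q.2| ≤ dist p q := le_max_right _ _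
  unfold armDist
  refine (abs_max_sub_max_le_max _ _ _ _).trans (max_le ?_ ?_)
  · refine (abs_max_sub_max_le_max _ _ _ _).trans (max_le ?_ (by simp))
    rw [sub_sub_sub_cancel_right]
    exact (abs_abs_sub_abs_le _ _).trans h2
  · refine (abs_max_sub_max_le_max _ _ _ _).trans (max_le ?_ ?_)
    · rwa [sub_sub_sub_cancel_left, abs_sub_comm]
    · rwa [sub_sub_sub_cancel_right, sub_sub_sub_cancel_right]

theorem abs_armFun_sub_le (j : ℕ) (p q : ℝ × ℝ) : |armFun j p - armFun j q| ≤ dist p q := by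
  have h1 : |p.1 - q.1| ≤ dist p q := le_max_left _ _
  have h2 := (abs_clamp_sub_le (armLength j) p.1 q.1).trans h1
  have h3 := abs_armDist_sub_le j p q
  unfold armFun
  rw [abs_le] at *
  constructor <;> linarith

/-- Maxima and compositions with the 1-Lipschitz foldings preserve the constant 1; each arm function
has slope at most 1/256 + 1/2. -/
theorem abs_treeFun_sub_le (j : ℕ) (p q : ℝ × ℝ) : |treeFun j p - treeFun j q| ≤ dist p q := by
  induction j generalizing p q with
  | zero =>
    refine (abs_max_sub_max_le_max _ _ _ _).trans (max_le (by simp) (abs_armFun_sub_le _ _ _))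
  | succ j ih =>
    exact (abs_max_sub_max_le_max _ _ _ _).trans
      (max_le ((ih _ _).trans (dist_fold_le j p q)) (abs_armFun_sub_le _ _ _))

theorem treeFun_nonneg (j : ℕ) (p : ℝ × ℝ) : 0 ≤ treeFun j p := by
  induction j generalizing p with
  | zero => exact le_max_left _ _
  | succ j ih => exact (ih _).trans (le_max_left _ _)

theorem armFun_le_treeFun (j : ℕ) (p : ℝ × ℝ) : armFun j p ≤ treeFun j p := by
  cases j <;> exact le_max_right _ _

theorem armDist_nonneg (j : ℕ) (p : ℝ × ℝ) : 0 ≤ armDist j p :=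
  (le_max_right _ _).trans (le_max_left _ _)

theorem abs_sub_le_armDist (j : ℕ) (p : ℝ × ℝ) : |p.2| - 1 / 4 ≤ armDist j p :=
  (le_max_left _ _).trans (le_max_left _ _)

theorem armFun_le (j : ℕ) (p : ℝ × ℝ) : armFun j p ≤ totalTime (j + 1) - armDist j p / 2 := by
  have : max 0 (min p.1 (armLength j)) ≤ armLength j :=
    max_le (by linarith [le_armLength j]) (min_le_right _ _)
  rw [totalTime_succ]
  unfold armFun
  rw [armLength_eq] at *
  linarith

theorem treeFun_le (j : ℕ) (p : ℝ × ℝ) : treeFun j p ≤ totalTime (j + 1) := by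
  induction j generalizing p with
  | zero =>
    exact max_le (totalTime_nonneg _) ((armFun_le 0 p).trans (by linarith [armDist_nonneg 0 p]))
  | succ j ih =>
    refine max_le ((ih _).trans ?_) ((armFun_le _ p).trans (by linarith [armDist_nonneg (j + 1) p]))
    rw [totalTime_succ (j + 1)]
    linarith [eight_le_armTime (j + 1)]

theorem armDist_eq_zero {j : ℕ} {p : ℝ × ℝ} (h2 : |p.2| ≤ 1 / 4) (h1 : -(1 / 4) ≤ p.1)
    (h1' : p.1 ≤ armLength j + 1 / 4) : armDist j p = 0 := by
  unfold armDist
  rw [max_eq_right (by linarith : |p.2| - 1 / 4 ≤ 0)]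
  exact max_eq_left (max_le (by linarith) (by linarith))

theorem armFun_eq {j : ℕ} {p : ℝ × ℝ} (h2 : |p.2| ≤ 1 / 4) (h1 : -(1 / 4) ≤ p.1)
    (h1' : p.1 ≤ armLength j + 1 / 4) :
    armFun j p = totalTime j + max 0 (min p.1 (armLength j)) / 256 := by
  rw [armFun, armDist_eq_zero h2 h1 h1']; ring

theorem totalTime_le_armFun {j : ℕ} {p : ℝ × ℝ} (h2 : |p.2| ≤ 1 / 4) (h1 : -(1 / 4) ≤ p.1)
    (h1' : p.1 ≤ armLength j + 1 / 4) : totalTime j ≤ armFun j p := by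
  rw [armFun_eq h2 h1 h1']
  linarith [le_max_left 0 (min p.1 (armLength j))]

/-- Near the main arm the arm function is at least `totalTime j`, which the subtrees never exceed.
-/
theorem treeFun_eq_armFun {j : ℕ} {p : ℝ × ℝ} (h2 : |p.2| ≤ 1 / 4) (h1 : -(1 / 4) ≤ p.1)
    (h1' : p.1 ≤ armLength j + 1 / 4) : treeFun j p = armFun j p := by
  have h := totalTime_le_armFun h2 h1 h1'
  cases j with
  | zero => exact max_eq_right ((totalTime_nonneg 0).trans h)
  | succ j => exact max_eq_right ((treeFun_le j _).trans h)

theorem treeFun_root (j : ℕ) : treeFun j (armLength j, 0) = totalTime (j + 1) := by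
  have h := le_armLength j
  rw [treeFun_eq_armFun (by simp) (by simp; linarith) (by simp), armFun_eq (by simp)
    (by simp; linarith) (by simp), totalTime_succ]
  simp only [min_self, max_eq_right (by linarith : 0 ≤ armLength j)]
  rw [armLength_eq]; ring

theorem treeTube_bounds {j : ℕ} {p : ℝ × ℝ} (hp : p ∈ treeTube j) :
    |p.1| ≤ armLength j ∧ |p.2| ≤ halfWidth j := by
  induction j generalizing p with
  | zero =>
    obtain ⟨h1, h2, h3⟩ := hp
    have := le_armLength 0
    refine ⟨abs_le.2 ⟨by linarith, by linarith⟩, ?_⟩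
    simp only [halfWidth]; linarith
  | succ j ih =>
    have h4 := le_armLength j
    have h5 := le_armLength (j + 1)
    rcases hp with ⟨h1, h2, h3⟩ | hp
    · refine ⟨abs_le.2 ⟨by linarith, by linarith⟩, ?_⟩
      simp only [halfWidth]; linarith
    · obtain ⟨h1, h2⟩ := ih hp
      simp only [fold] at h1 h2
      refine ⟨h2.trans (halfWidth_le_armLength j), ?_⟩
      simp only [halfWidth]
      linarith [(abs_le.1 h1).1]

/-- Inside the tubes of a subtree the new arm must not win the maximum, or the time would drop there
at slope 1/2 instead of 1/256. -/
theorem armFun_succ_le_treeFun {j : ℕ} {p : ℝ × ℝ} (hp : fold j p ∈ treeTube j) :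
    armFun (j + 1) p ≤ treeFun j (fold j p) := by
  have hd := abs_sub_le_armDist (j + 1) p
  have harm : fold j p ∈ armTube j → armFun (j + 1) p ≤ treeFun j (fold j p) := by
    -- On the arm adjacent to the junction, the tube stops 3/4 before its end, so `|p.2| > 3/4`.
    -- There the penalty `(|p.2| - 1/4)/2` already outweighs the terms of order 1/256.
    rintro ⟨h1, h2, h3⟩
    refine le_trans ?_ (armFun_le_treeFun j _)
    rw [armFun_eq h1.le h2.le (by linarith)]
    simp only [fold] at h1 h2 h3 ⊢
    have h4 : armLength j - |p.2| ≤ max 0 (min (armLength j - |p.2|) (armLength j)) :=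
      le_max_of_le_right (le_min le_rfl (by linarith [abs_nonneg p.2]))
    have h5 : max 0 (min p.1 (armLength (j + 1))) ≤ 1 / 4 :=
      max_le (by norm_num) ((min_le_left _ _).trans ((le_abs_self _).trans h1.le))
    unfold armFun
    rw [totalTime_succ]
    have h6 := armLength_eq j
    linarith
  cases j with
  | zero => exact harm hp
  | succ j =>
    rcases hp with hp | hp
    · exact harm hp
    -- Deeper arms are so far from the new arm, by `halfWidth_le`, that its function is negative on
    -- them.
    · refine le_trans ?_ (treeFun_nonneg _ _)
      have h1 := (treeTube_bounds hp).2
      simp only [fold] at h1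
      have h2 := halfWidth_le j
      have h3 := armFun_le (j + 1 + 1) p
      simp only [add_assoc, Nat.reduceAdd] at *
      linarith [le_abs_self (armLength (j + 1) - |p.2|)]

theorem treeFun_succ_of_fold_mem {j : ℕ} {p : ℝ × ℝ} (hp : fold j p ∈ treeTube j) :
    treeFun (j + 1) p = treeFun j (fold j p) :=
  max_eq_left (armFun_succ_le_treeFun hp)

/-- On a tube the function of a single arm survives and `armDist` vanishes, which leaves only the
slope 1/256; the induction passes through the 1-Lipschitz folding. -/
theorem eventually_abs_treeFun_sub_le {j : ℕ} {p : ℝ × ℝ} (hp : p ∈ treeTube j) :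
    ∀ᶠ q in 𝓝 p, |treeFun j q - treeFun j p| ≤ 1 / 256 * dist q p := by
  have harm : ∀ j, ∀ p ∈ armTube j,
      ∀ᶠ q in 𝓝 p, |treeFun j q - treeFun j p| ≤ 1 / 256 * dist q p := by
    intro j p hp
    have heq : ∀ q ∈ armTube j,
        treeFun j q = totalTime j + max 0 (min q.1 (armLength j)) / 256 := by
      rintro q ⟨h1, h2, h3⟩
      rw [treeFun_eq_armFun h1.le h2.le (by linarith), armFun_eq h1.le h2.le (by linarith)]
    filter_upwards [(isOpen_armTube j).mem_nhds hp] with q hq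
    rw [heq q hq, heq p hp]
    have h1 : |q.1 - p.1| ≤ dist q p := le_max_left _ _
    have h2 := (abs_clamp_sub_le (armLength j) q.1 p.1).trans h1
    rw [abs_le] at *
    constructor <;> linarith
  induction j generalizing p with
  | zero => exact harm 0 p hp
  | succ j ih =>
    rcases hp with hp | hp
    · exact harm _ p hp
    · filter_upwards [(continuous_fold j).continuousAt.eventually (ih hp),
        ((isOpen_treeTube j).preimage (continuous_fold j)).mem_nhds hp] with q hq hq'
      rw [treeFun_succ_of_fold_mem hq', treeFun_succ_of_fold_mem hp]
      refine hq.trans ?_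
      gcongr
      exact dist_fold_le j q p

/-- Bounded support allows trees of all levels to be placed side by side without interaction. -/
theorem exists_treeFun_support (j : ℕ) : ∃ N : ℕ, ∀ p : ℝ × ℝ, (N ≤ |p.1| ∨ N ≤ |p.2|) →
    treeFun j p = 0 ∧ p ∉ treeTube j := by
  have harm : ∀ j, ∀ p : ℝ × ℝ,
      (2 * totalTime (j + 1) + armLength j + 1 ≤ |p.1| ∨
        2 * totalTime (j + 1) + armLength j + 1 ≤ |p.2|) → armFun j p ≤ 0 ∧ p ∉ armTube j := by
    intro j p hp
    have h0 := totalTime_nonneg (j + 1)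
    have h1 := le_armLength j
    refine ⟨(armFun_le j p).trans ?_, ?_⟩
    · have h2 := abs_sub_le_armDist j p
      have h3 : -(1 / 4) - p.1 ≤ armDist j p := (le_max_left _ _).trans (le_max_right _ _)
      have h4 : p.1 - armLength j - 1 / 4 ≤ armDist j p := (le_max_right _ _).trans (le_max_right _ _)
      rcases hp with hp | hp
      · rcases le_abs.1 hp with hp | hp <;> linarith
      · linarith
    · rintro ⟨h2, h3, h4⟩
      rcases hp with hp | hp
      · rcases le_abs.1 hp with hp | hp <;> linarith
      · linarith
  induction j with
  | zero =>
    obtain ⟨N, hN⟩ := exists_nat_ge (2 * totalTime (0 + 1) + armLength 0 + 1)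
    refine ⟨N, fun p hp => ?_⟩
    have := harm 0 p (hp.imp hN.trans hN.trans)
    exact ⟨max_eq_left this.1, this.2⟩
  | succ j ih =>
    obtain ⟨N, hN⟩ := ih
    obtain ⟨N', hN'⟩ :=
      exists_nat_ge (2 * totalTime (j + 1 + 1) + armLength (j + 1) + 1 + N + armLength j)
    have h1 := le_armLength j
    have h2 := le_armLength (j + 1)
    have h3 := totalTime_nonneg (j + 1 + 1)
    refine ⟨N', fun p hp => ?_⟩
    have h4 := harm (j + 1) p (hp.imp (fun h => by linarith) (fun h => by linarith))
    have h5 := hN (fold j p) (by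
      rcases hp with hp | hp
      · right; simp only [fold]; linarith
      · left; simp only [fold]; rw [abs_sub_comm]; refine le_trans ?_ (le_abs_self _); linarith)
    refine ⟨?_, fun h => h.elim h4.2 h5.2⟩
    simp only [treeFun]
    rw [h5.1]
    exact max_eq_left h4.1

/-! ### Leaves, and the travel time along the arms. -/

/-- An integer point as a point of the plane. -/
def realPoint (q : ℤ × ℤ) : ℝ × ℝ := (q.1, q.2)

/-- The embedding of a tree of level `j` as a subtree of the tree of level `j + 1`, on the side
given by the sign `s`. -/
def place (s : ℤ) (j : ℕ) (q : ℤ × ℤ) : ℤ × ℤ := (q.2, s * (256 * armTime j - q.1))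

/-- The end of the arm of level `j`. -/
def treeRoot (j : ℕ) : ℤ × ℤ := (256 * armTime j, 0)

/-- The leaves of the tree of level `j`. -/
def treeLeaves : ℕ → Finset (ℤ × ℤ)
  | 0 => {(0, 0)}
  | j + 1 => (treeLeaves j).image (place 1 j) ∪ (treeLeaves j).image (place (-1) j)

/-- No tube reaches the line of reflection of `fold j`. Hence `fold` inverts `place` on leaves, and
the two copies of a subtree have disjoint leaves. -/
theorem fst_lt_of_mem_treeTube {j : ℕ} {p : ℝ × ℝ} (hp : p ∈ treeTube j) :
    p.1 < armLength j := by
  have harm : ∀ j, p ∈ armTube j → p.1 < armLength j := fun j h => by linarith [h.2.2]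
  cases j with
  | zero => exact harm 0 hp
  | succ j =>
    rcases hp with hp | hp
    · exact harm _ hp
    · have h1 := (treeTube_bounds hp).2
      simp only [fold] at h1
      linarith [halfWidth_le j, totalTime_nonneg (j + 3), le_abs_self p.1]

theorem fold_place {s : ℤ} (hs : |s| = 1) {j : ℕ} {q : ℤ × ℤ} (hq : (q.1 : ℝ) ≤ armLength j) :
    fold j (realPoint (place s j q)) = realPoint q := by
  have hs' : |(s : ℝ)| = 1 := by exact_mod_cast hs
  simp only [fold, realPoint, place, Prod.mk.injEq, and_true]
  push_cast
  rw [← armLength_eq, abs_mul, hs', one_mul, abs_of_nonneg (by linarith)]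
  ring

theorem exists_place_of_mem_treeLeaves {j : ℕ} {e : ℤ × ℤ} (he : e ∈ treeLeaves (j + 1)) :
    ∃ s : ℤ, |s| = 1 ∧ ∃ q ∈ treeLeaves j, place s j q = e := by
  simp only [treeLeaves, Finset.mem_union, Finset.mem_image] at he
  rcases he with ⟨q, hq, h⟩ | ⟨q, hq, h⟩
  · exact ⟨1, by simp, q, hq, h⟩
  · exact ⟨-1, by simp, q, hq, h⟩

theorem realPoint_mem_treeTube {j : ℕ} {e : ℤ × ℤ} (he : e ∈ treeLeaves j) :
    realPoint e ∈ treeTube j := by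
  induction j generalizing e with
  | zero =>
    obtain rfl : e = (0, 0) := by simpa [treeLeaves] using he
    have := le_armLength 0
    refine ⟨by simp [realPoint], by simp [realPoint], ?_⟩
    simp only [realPoint]; push_cast; linarith
  | succ j ih =>
    obtain ⟨s, hs, q, hq, rfl⟩ := exists_place_of_mem_treeLeaves he
    right
    rw [mem_preimage, fold_place hs (fst_lt_of_mem_treeTube (ih hq)).le]
    exact ih hq

theorem treeFun_leaf {j : ℕ} {e : ℤ × ℤ} (he : e ∈ treeLeaves j) : treeFun j (realPoint e) = 0 := by
  induction j generalizing e with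
  | zero =>
    have h := le_armLength 0
    obtain rfl : e = (0, 0) := by simpa [treeLeaves] using he
    rw [treeFun_eq_armFun (by simp [realPoint]) (by simp [realPoint])
      (by simp [realPoint]; linarith), armFun_eq (by simp [realPoint]) (by simp [realPoint])
      (by simp [realPoint]; linarith)]
    simp [realPoint, totalTime]
  | succ j ih =>
    obtain ⟨s, hs, q, hq, rfl⟩ := exists_place_of_mem_treeLeaves he
    have h1 := realPoint_mem_treeTube hq
    have h2 := fold_place hs (fst_lt_of_mem_treeTube h1).le
    rw [treeFun_succ_of_fold_mem (by rwa [h2]), h2, ih hq]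

theorem card_treeLeaves (j : ℕ) : (treeLeaves j).card = 2 ^ j := by
  induction j with
  | zero => simp [treeLeaves]
  | succ j ih =>
    have hinj : ∀ s : ℤ, |s| = 1 → Function.Injective (place s j) := by
      intro s hs p q h
      have hs' : s ≠ 0 := by rintro rfl; simp at hs
      simp only [place, Prod.mk.injEq, mul_eq_mul_left_iff, hs', or_false] at h
      exact Prod.ext (by linarith [h.2]) h.1
    rw [treeLeaves, Finset.card_union_of_disjoint, Finset.card_image_of_injective _ (hinj 1 (by simp)),
      Finset.card_image_of_injective _ (hinj (-1) (by simp)), ih]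
    · ring
    · rw [Finset.disjoint_left]
      intro e h1 h2
      obtain ⟨p, hp, rfl⟩ := Finset.mem_image.1 h1
      obtain ⟨q, hq, h⟩ := Finset.mem_image.1 h2
      have h3 := fst_lt_of_mem_treeTube (realPoint_mem_treeTube hp)
      have h4 := fst_lt_of_mem_treeTube (realPoint_mem_treeTube hq)
      simp only [realPoint, armLength_eq] at h3 h4
      have h3' : p.1 < 256 * armTime j := by exact_mod_cast h3
      have h4' : q.1 < 256 * armTime j := by exact_mod_cast h4
      simp only [place, Prod.mk.injEq] at h
      linarith [h.2]

/-- The distance is abstract so as to cover both the graph and the Riemannian one. The error 2 is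
the additive 1 of fast travel plus one slow unit step. -/
theorem arm_le (j : ℕ) (d : ℤ × ℤ → ℤ × ℤ → ℝ) (htri : ∀ x y z, d x z ≤ d x y + d y z)
    (hunit : ∀ p u : ℤ × ℤ, |u.1| + |u.2| = 1 → d p (p + u) ≤ 1)
    (hfast : ∀ p u : ℤ × ℤ, |u.1| + |u.2| = 1 → ∀ n : ℕ,
      (∀ t ∈ Icc (0 : ℝ) n, ((p.1 + t * u.1, p.2 + t * u.2) : ℝ × ℝ) ∈ armCore j) →
      d p (p + n • u) ≤ n / 256 + 1) : d (0, 0) (treeRoot j) ≤ armTime j + 2 := by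
  -- The core of the arm stops one unit before its end.
  obtain ⟨n, hn⟩ : ∃ n : ℕ, n + 1 = 256 * armTime j :=
    ⟨256 * armTime j - 1, by have := eight_le_growth (j / 2); unfold armTime; omega⟩
  have hn' : (n : ℝ) + 1 = 256 * armTime j := by exact_mod_cast hn
  have h1 := hfast (0, 0) (1, 0) (by simp) n (fun t ht => by
    refine ⟨by simp, by simpa using ht.1, ?_⟩
    rw [armLength_eq, ← hn']
    simpa using ht.2)
  have h2 := hunit ((0, 0) + n • (1, 0)) (1, 0) (by simp)
  have h3 : ((0, 0) + n • (1, 0) + (1, 0) : ℤ × ℤ) = treeRoot j := by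
    have : (n : ℤ) + 1 = 256 * armTime j := by exact_mod_cast hn
    simp [treeRoot, this]
  rw [h3] at h2
  have := htri (0, 0) ((0, 0) + n • (1, 0)) (treeRoot j)
  linarith
/-- The distance from a leaf to the root is at most the total time, up to a bounded error for each
level, if the unit segments have length at most `1` and the arms are run through at speed `256`. -/
theorem leaf_root_le (j : ℕ) (d : ℤ × ℤ → ℤ × ℤ → ℝ) (htri : ∀ x y z, d x z ≤ d x y + d y z)
    (hunit : ∀ p u : ℤ × ℤ, |u.1| + |u.2| = 1 → d p (p + u) ≤ 1)
    (hfast : ∀ p u : ℤ × ℤ, |u.1| + |u.2| = 1 → ∀ n : ℕ,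
      (∀ t ∈ Icc (0 : ℝ) n, ((p.1 + t * u.1, p.2 + t * u.2) : ℝ × ℝ) ∈ treeCore j) →
      d p (p + n • u) ≤ n / 256 + 1)
    {e : ℤ × ℤ} (he : e ∈ treeLeaves j) : d e (treeRoot j) ≤ totalTime (j + 1) + 2 * (j + 1) := by
  induction j generalizing d e with
  | zero =>
    obtain rfl : e = (0, 0) := by simpa [treeLeaves] using he
    have := arm_le 0 d htri hunit hfast
    simp only [totalTime, zero_add, Finset.sum_range_one]
    push_cast
    linarith
  | succ j ih =>
    obtain ⟨s, hs, q, hq, rfl⟩ := exists_place_of_mem_treeLeaves he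
    have hplace : ∀ (p u : ℤ × ℤ) (n : ℕ),
        place s j (p + n • u) = place s j p + n • ((u.2, -(s * u.1)) : ℤ × ℤ) := by
      intro p u n
      ext
      · simp [place]
      · simp [place]; ring
    have hstep : ∀ u : ℤ × ℤ, |u.1| + |u.2| = 1 →
        |((u.2, -(s * u.1)) : ℤ × ℤ).1| + |((u.2, -(s * u.1)) : ℤ × ℤ).2| = 1 := by
      intro u hu
      rw [abs_neg, abs_mul, hs, one_mul, add_comm]
      exact hu
    have hs' : |(s : ℝ)| = 1 := by exact_mod_cast hs
    -- The induction hypothesis is applied to the distance pulled back to the subtree, whose root is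
    -- the origin.
    have h1 := ih (fun x y => d (place s j x) (place s j y)) (fun x y z => htri _ _ _) ?_ ?_ hq
    · have h2 := arm_le (j + 1) d htri hunit fun p u hu n h => hfast p u hu n fun t ht => Or.inl (h t ht)
      have h3 : place s j (treeRoot j) = (0, 0) := by simp [place, treeRoot]
      rw [h3] at h1
      have := htri (place s j q) (0, 0) (treeRoot (j + 1))
      rw [totalTime_succ (j + 1)]
      push_cast
      linarith
    · intro p u hu
      have := hplace p u 1
      simp only [one_smul] at this
      change d (place s j p) (place s j (p + u)) ≤ 1
      rw [this]
      exact hunit _ _ (hstep u hu)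
    · intro p u hu n h
      rw [hplace]
      refine hfast _ _ (hstep u hu) n fun t ht => Or.inr ?_
      have hm := h t ht
      have hlt := fst_lt_of_mem_treeTube (treeCore_subset_treeTube j hm)
      rw [mem_preimage]
      convert hm using 1
      simp only [fold, place, Prod.mk.injEq]
      push_cast
      refine ⟨?_, trivial⟩
      rw [show (s : ℝ) * (256 * armTime j - p.1) + t * -(s * u.1)
        = s * (armLength j - (p.1 + t * u.1)) by rw [armLength_eq]; ring, abs_mul, hs', one_mul,
        abs_of_nonneg (by linarith)]
      ring

/-! ### All trees in one plane, and the conformal factor. -/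

/-- The plane in the coordinates centred at `(c, 0)`. -/
def coords (c : ℤ) (p : Plane) : ℝ × ℝ := (p 0 - c, p 1)

theorem continuous_coords (c : ℤ) : Continuous (coords c) := by unfold coords; fun_prop

theorem dist_coords_le (c : ℤ) (p q : Plane) : dist (coords c q) (coords c p) ≤ ‖q - p‖ := by
  have h : ∀ i, |q i - p i| ≤ ‖q - p‖ := fun i => by
    simpa using PiLp.norm_apply_le (q - p) i
  rw [Prod.dist_eq, Real.dist_eq, Real.dist_eq]
  simp only [coords, sub_sub_sub_cancel_right]
  exact max_le (h 0) (h 1)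

/-- Successive disjoint vertical strips of half-width `N k`. The second property makes the family
locally finite. -/
theorem exists_separated_centers (N : ℕ → ℕ) : ∃ c : ℕ → ℤ,
    (∀ k l : ℕ, k ≠ l → ∀ x : ℝ, |x - c l| < N l → (N k : ℝ) < |x - c k|) ∧
    ∀ (k : ℕ) (x : ℝ), |x - c k| < N k → (k : ℝ) < x := by
  set P : ℕ → ℕ := fun k => ∑ i ∈ Finset.range k, 2 * (N i + 1) with hP
  have hPs : ∀ k, P (k + 1) = P k + 2 * (N k + 1) := fun k => Finset.sum_range_succ _ _
  have hPm : Monotone P := monotone_nat_of_le_succ fun k => by rw [hPs]; omega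
  have hPk : ∀ k, k ≤ P k := fun k => by
    induction k with
    | zero => simp
    | succ k ih => rw [hPs]; omega
  refine ⟨fun k => (P k + (N k + 1) : ℕ), fun k l hkl x hx => ?_, fun k x hx => ?_⟩
  · have hPl : (P (l + 1) : ℝ) = P l + 2 * (N l + 1) := by exact_mod_cast hPs l
    have hPk : (P (k + 1) : ℝ) = P k + 2 * (N k + 1) := by exact_mod_cast hPs k
    push_cast at hx ⊢
    rw [abs_lt] at hx
    rw [lt_abs]
    rcases lt_or_gt_of_ne hkl with h | h
    · left
      have : (P (k + 1) : ℝ) ≤ P l := by exact_mod_cast hPm h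
      linarith
    · right
      have : (P (l + 1) : ℝ) ≤ P k := by exact_mod_cast hPm h
      linarith
  · have : (k : ℝ) ≤ P k := by exact_mod_cast hPk k
    push_cast at hx
    rw [abs_lt] at hx
    linarith

/-- A conformal factor that is small exactly along the arms of copies of the trees of all levels,
with the property that the time functions of all trees are `1`-Lipschitz. -/
theorem exists_conformal_factor : ∃ (ρ : Plane → ℝ) (c : ℕ → ℤ), ContDiff ℝ ∞ ρ ∧
    (∀ x, 1 / 256 ≤ ρ x) ∧ (∀ x, ρ x ≤ 1) ∧
    (∀ k p, coords (c k) p ∈ treeCore k → ρ p ≤ 1 / 256) ∧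
    ∀ k p, ∀ᶠ q in 𝓝 p,
      |treeFun k (coords (c k) q) - treeFun k (coords (c k) p)| ≤ ρ p * ‖q - p‖ := by
  choose N hN using exists_treeFun_support
  obtain ⟨c, hc1, hc2⟩ := exists_separated_centers N
  have htube : ∀ k p, coords (c k) p ∈ treeTube k → |p 0 - c k| < N k := fun k p hp => by
    by_contra h
    exact (hN k (coords (c k) p) (Or.inl (not_lt.1 h))).2 hp
  set A : Set Plane := ⋃ k, coords (c k) ⁻¹' treeCore k with hA
  set T : Set Plane := ⋃ k, coords (c k) ⁻¹' treeTube k with hT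
  have hAT : A ⊆ T := iUnion_mono fun k => preimage_mono (treeCore_subset_treeTube k)
  have hTo : IsOpen T := isOpen_iUnion fun k => (isOpen_treeTube k).preimage (continuous_coords _)
  have hAc : IsClosed A := by
    -- A half-plane bounded on the right meets only finitely many trees.
    refine LocallyFinite.isClosed_iUnion (fun p => ?_)
      fun k => (isClosed_treeCore k).preimage (continuous_coords _)
    refine ⟨{q | q 0 < p 0 + 1}, IsOpen.mem_nhds (isOpen_lt (by fun_prop) (by fun_prop))
      (by simp), ?_⟩
    refine (finite_lt_nat ⌈p 0 + 1⌉₊).subset ?_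
    rintro k ⟨q, hq1, hq2⟩
    have h := hc2 k (q 0) (htube k q (treeCore_subset_treeTube k hq1))
    exact Nat.lt_ceil.2 (h.trans hq2)
  obtain ⟨f, hf0, hf1, hf⟩ := exists_contMDiffMap_zero_one_of_isClosed (n := (⊤ : ℕ∞)) 𝓘(ℝ, Plane) hAc
    hTo.isClosed_compl (disjoint_left.2 fun x hx hx' => hx' (hAT hx))
  have hfs : ContDiff ℝ ∞ f := contMDiff_iff_contDiff.1 f.contMDiff
  refine ⟨fun x => 1 / 256 + 255 / 256 * f x, c, by fun_prop, fun x => ?_, fun x => ?_,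
    fun k p hp => ?_, fun k p => ?_⟩
  · linarith [(hf x).1]
  · linarith [(hf x).2]
  · simp [hf0 (mem_iUnion.2 ⟨k, hp⟩ : p ∈ A)]
  · beta_reduce
    by_cases hp : p ∈ T
    · have hρ : ∀ q : Plane, 1 / 256 * ‖q - p‖ ≤ (1 / 256 + 255 / 256 * f p) * ‖q - p‖ := fun q =>
        mul_le_mul_of_nonneg_right (by linarith [(hf p).1]) (norm_nonneg _)
      obtain ⟨l, hl⟩ := mem_iUnion.1 hp
      by_cases hkl : k = l
      · subst hkl
        filter_upwards [(continuous_coords (c k)).continuousAt.eventually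
          (eventually_abs_treeFun_sub_le hl)] with q hq
        refine hq.trans (le_trans ?_ (hρ q))
        gcongr
        exact dist_coords_le _ _ _
      -- In the tube of another tree, the time function vanishes near the point.
      · have h1 := hc1 k l hkl (p 0) (htube l p hl)
        have hopen : IsOpen {q : Plane | (N k : ℝ) < |q 0 - c k|} :=
          isOpen_lt (by fun_prop) (by fun_prop)
        filter_upwards [hopen.mem_nhds h1] with q hq
        rw [(hN k (coords (c k) q) (Or.inl (le_of_lt hq))).1,
          (hN k (coords (c k) p) (Or.inl (le_of_lt h1))).1, sub_self, abs_zero]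
        exact mul_nonneg (by linarith [(hf p).1]) (norm_nonneg _)
    -- Off all tubes `ρ` equals 1, and the Euclidean Lipschitz constant suffices.
    · rw [hf1 (show p ∈ Tᶜ from hp)]
      refine Eventually.of_forall fun q => ?_
      refine (abs_treeFun_sub_le _ _ _).trans ((dist_coords_le _ _ _).trans_eq ?_)
      norm_num

/-- The integer points of the plane. -/
def intPoint (q : ℤ × ℤ) : Plane := !₂[(q.1 : ℝ), (q.2 : ℝ)]

/-- The leaves of the `k`-th tree, when placed at `(c, 0)`, are far from the root. -/
theorem le_dist_leaf_root {ρ : Plane → ℝ} {k : ℕ} {c : ℤ} {d : Plane → Plane → ℝ}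
    (hρ : ∀ p, ∀ᶠ q in 𝓝 p, |treeFun k (coords c q) - treeFun k (coords c p)| ≤ ρ p * ‖q - p‖)
    (hd : ∀ v : Plane → ℝ, (∀ p, ∀ᶠ q in 𝓝 p, |v q - v p| ≤ ρ p * ‖q - p‖) →
      ∀ x y, v y - v x ≤ d x y) {e : ℤ × ℤ} (he : e ∈ treeLeaves k) :
    totalTime (k + 1) ≤ d (intPoint (e + (c, 0))) (intPoint (treeRoot k + (c, 0))) := by
  have h := hd _ hρ (intPoint (e + (c, 0))) (intPoint (treeRoot k + (c, 0)))
  have h1 : ∀ q : ℤ × ℤ, coords c (intPoint (q + (c, 0))) = realPoint q := fun q => by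
    simp [coords, intPoint, realPoint]
  have h2 : realPoint (treeRoot k) = (armLength k, 0) := by
    simp [realPoint, treeRoot, armLength_eq]
  rwa [h1, h1, treeFun_leaf he, h2, treeFun_root, sub_zero] at h

theorem norm_intPoint_sub (p u : ℤ × ℤ) (n : ℕ) (hu : |u.1| + |u.2| = 1) :
    ‖intPoint (p + n • u) - intPoint p‖ = n := by
  have hu' : |(u.1 : ℝ)| + |(u.2 : ℝ)| = 1 := by exact_mod_cast hu
  have h : (u.1 = 0 ∧ |(u.2 : ℝ)| = 1) ∨ (|(u.1 : ℝ)| = 1 ∧ u.2 = 0) := by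
    rcases eq_or_ne u.1 0 with h | h
    · left; refine ⟨h, ?_⟩; simpa [h] using hu'
    · right
      have h3 : 1 ≤ |u.1| := Int.one_le_abs h
      have h4 : |u.2| = 0 := le_antisymm (by linarith) (abs_nonneg _)
      have h5 : u.2 = 0 := abs_eq_zero.1 h4
      refine ⟨?_, h5⟩
      simpa [h5] using hu'
  rw [EuclideanSpace.norm_eq]
  simp only [intPoint, Fin.sum_univ_two, PiLp.sub_apply]
  rcases h with ⟨h1, h2⟩ | ⟨h1, h2⟩
  · simp [h1, h2]
  · simp [h1, h2]

theorem dist_le_of_unit {d : Plane → Plane → ℝ} (hd : ∀ x y, d x y ≤ ‖y - x‖) (p u : ℤ × ℤ)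
    (hu : |u.1| + |u.2| = 1) : d (intPoint p) (intPoint (p + u)) ≤ 1 := by
  have := norm_intPoint_sub p u 1 hu
  rw [one_smul] at this
  simpa [this] using hd (intPoint p) (intPoint (p + u))

/-- Fast travel along the arms. -/
theorem dist_le_of_treeCore {ρ : Plane → ℝ} {k : ℕ} {c : ℤ} {d : Plane → Plane → ℝ}
    (hρ : ∀ p, coords c p ∈ treeCore k → ρ p ≤ 1 / 256)
    (hd : ∀ (x y : Plane) (b : ℝ), 0 ≤ b → (∀ t ∈ Icc (0 : ℝ) 1, ρ (x + t • (y - x)) ≤ b) →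
      d x y ≤ b * ‖y - x‖) (p u : ℤ × ℤ) (hu : |u.1| + |u.2| = 1) (n : ℕ)
    (h : ∀ t ∈ Icc (0 : ℝ) n, ((p.1 + t * u.1, p.2 + t * u.2) : ℝ × ℝ) ∈ treeCore k) :
    d (intPoint (p + (c, 0))) (intPoint (p + n • u + (c, 0))) ≤ n / 256 := by
  have h1 := hd (intPoint (p + (c, 0))) (intPoint (p + n • u + (c, 0))) (1 / 256) (by norm_num)
    fun t ht => hρ _ ?_
  · rw [show p + n • u + (c, 0) = p + (c, 0) + n • u by abel, norm_intPoint_sub _ _ _ hu] at h1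
    rw [show p + n • u + (c, 0) = p + (c, 0) + n • u by abel]
    linarith
  · have h2 := h (t * n) ⟨mul_nonneg ht.1 (Nat.cast_nonneg n),
      mul_le_of_le_one_left (Nat.cast_nonneg n) ht.2⟩
    convert h2 using 1
    simp only [coords, intPoint, Prod.mk.injEq]
    constructor
    · simp; ring
    · simp; ring

/-! ### Comparison of exponents, and pigeonhole. -/

theorem totalTime_le_pow (m : ℕ) : totalTime (2 * m + 1) ≤ 32 * (9 / 4 : ℝ) ^ m := by
  have h1 := totalTime_succ_le (2 * m)
  have h2 := growth_le_pow m
  have h3 : armTime (2 * m) = growth m := by simp [armTime]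
  rw [h3] at h1
  linarith

theorem log_three_div_log_two_lt : Real.log 3 / Real.log 2 < 8 / 5 := by
  have h : Real.log ((3 : ℝ) ^ 5) < Real.log ((2 : ℝ) ^ 8) :=
    Real.log_lt_log (by norm_num) (by norm_num)
  rw [Real.log_pow, Real.log_pow] at h
  rw [div_lt_iff₀ (Real.log_pos one_lt_two)]
  push_cast at h
  linarith

/-- With 8/5 as an upper bound for the exponent, `r` to that power is O(q^m) where `q = (9/4)^(8/5)
< 4`, because 9^8 < 4^13. The gap between `q` and 4 beats the linear factor. -/
theorem eventually_rpow_mul_lt (C : ℝ) : ∀ᶠ m : ℕ in atTop, ∀ r : ℝ, 1 ≤ r →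
    r ≤ totalTime (2 * m + 1) + 4 * m + 4 →
    C * r ^ (Real.log 3 / Real.log 2) * (16 * m + 16) < 4 ^ m := by
  set q : ℝ := (9 / 4 : ℝ) ^ (8 / 5 : ℝ) with hq
  have hq0 : 0 < q := by positivity
  have hq4 : q < 4 := by
    refine lt_of_pow_lt_pow_left₀ 5 (by norm_num) ?_
    rw [hq, ← Real.rpow_mul_natCast (by norm_num), show (8 / 5 : ℝ) * (5 : ℕ) = (8 : ℕ) by norm_num,
      Real.rpow_natCast]
    norm_num
  have hlim : Tendsto (fun m : ℕ => |C| * (36 : ℝ) ^ (8 / 5 : ℝ) *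
      (16 * ((m : ℝ) ^ 1 * (q / 4) ^ m) + 16 * ((m : ℝ) ^ 0 * (q / 4) ^ m))) atTop
      (𝓝 (|C| * (36 : ℝ) ^ (8 / 5 : ℝ) * (16 * 0 + 16 * 0))) := by
    have habs : |q / 4| < 1 := by rw [abs_of_pos (by positivity)]; linarith
    exact (((tendsto_pow_const_mul_const_pow_of_abs_lt_one 1 habs).const_mul 16).add
      ((tendsto_pow_const_mul_const_pow_of_abs_lt_one 0 habs).const_mul 16)).const_mul _
  filter_upwards [hlim.eventually_lt_const (show _ < (1 : ℝ) by norm_num)] with m hm r h1 hr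
  have hr' : r ≤ 36 * (9 / 4 : ℝ) ^ m := by
    have h2 := totalTime_le_pow m
    have h3 := one_add_mul_le_pow (a := (5 / 4 : ℝ)) (by norm_num) m
    rw [show (1 + 5 / 4 : ℝ) = 9 / 4 by norm_num] at h3
    have : (0 : ℝ) ≤ m := Nat.cast_nonneg m
    linarith
  have hpow : r ^ (Real.log 3 / Real.log 2) ≤ (36 : ℝ) ^ (8 / 5 : ℝ) * q ^ m := by
    calc r ^ (Real.log 3 / Real.log 2) ≤ r ^ (8 / 5 : ℝ) :=
          Real.rpow_le_rpow_of_exponent_le h1 log_three_div_log_two_lt.le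
      _ ≤ (36 * (9 / 4 : ℝ) ^ m) ^ (8 / 5 : ℝ) :=
          Real.rpow_le_rpow (by linarith) hr' (by norm_num)
      _ = _ := by
          rw [Real.mul_rpow (by norm_num) (by positivity), ← Real.rpow_natCast,
            ← Real.rpow_mul (by norm_num), mul_comm (m : ℝ), Real.rpow_mul (by norm_num),
            Real.rpow_natCast]
  have h4 : (0 : ℝ) < 4 ^ m := by positivity
  calc C * r ^ (Real.log 3 / Real.log 2) * (16 * m + 16)
      ≤ |C| * ((36 : ℝ) ^ (8 / 5 : ℝ) * q ^ m) * (16 * m + 16) := by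
        gcongr
        exact le_abs_self C
    _ = (|C| * (36 : ℝ) ^ (8 / 5 : ℝ) *
      (16 * ((m : ℝ) ^ 1 * (q / 4) ^ m) + 16 * ((m : ℝ) ^ 0 * (q / 4) ^ m))) * 4 ^ m := by
        rw [div_pow]; field_simp
    _ < 1 * 4 ^ m := by gcongr
    _ = 4 ^ m := one_mul _

theorem not_spheresDominatedBy {X : Type*} (d : X → X → ℝ) (vol : Set X → ℝ≥0∞) {κ : ℝ}
    (hκ : 0 < κ) (h : ∀ m : ℕ, ∃ (x : X) (r : ℝ), totalTime (2 * m + 1) - 1 ≤ r ∧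
      r ≤ totalTime (2 * m + 1) + 4 * m + 4 ∧
      ENNReal.ofReal (κ * (4 ^ m / (16 * m + 16))) ≤ vol (thickSphere d x r)) :
    ¬ SpheresDominatedBy d vol (fun r : ℝ => r ^ (Real.log 3 / Real.log 2)) := by
  rintro ⟨C, R, hCR⟩
  obtain ⟨m, hm, hmR, hm1⟩ := ((eventually_rpow_mul_lt (C / κ)).and
    ((eventually_ge_atTop ⌈R⌉₊).and (eventually_ge_atTop 1))).exists
  obtain ⟨x, r, hr1, hr2, hr3⟩ := h m
  have h1 : (1 : ℝ) ≤ m := by exact_mod_cast hm1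
  have h2 := le_totalTime (2 * m + 1)
  push_cast at h2
  have h3 : R ≤ m := (Nat.le_ceil R).trans (by exact_mod_cast hmR)
  have h4 := hr3.trans (hCR x r (by linarith))
  have h5 := hm r (by linarith) hr2
  have h6 : 0 < κ * (4 ^ m / (16 * m + 16)) := by positivity
  have h7 : κ * (4 ^ m / (16 * m + 16)) ≤ C * r ^ (Real.log 3 / Real.log 2) := by
    by_contra hlt
    exact absurd h4 (not_le.2 ((ENNReal.ofReal_lt_ofReal_iff h6).2 (not_le.1 hlt)))
  rw [mul_div_assoc', div_le_iff₀ (by positivity)] at h7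
  rw [div_mul_eq_mul_div, div_mul_eq_mul_div, div_lt_iff₀ hκ] at h5
  linarith

/-- Pigeonhole over the `N` consecutive windows of width `s`. -/
theorem exists_window {α : Type*} (L : Finset α) (D : α → ℝ) (a s : ℝ) (hs : 0 < s) (N : ℕ)
    (hN : 0 < N) (h : ∀ e ∈ L, a ≤ D e ∧ D e < a + s * N) :
    ∃ y : ℕ, y < N ∧ ∃ F ⊆ L, (L.card : ℝ) / N ≤ F.card ∧
      ∀ e ∈ F, a + s * y ≤ D e ∧ D e < a + s * (y + 1) := by
  have hN' : (0 : ℝ) < N := by exact_mod_cast hN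
  have h0 : ∀ e ∈ L, 0 ≤ (D e - a) / s := fun e he =>
    div_nonneg (by linarith [(h e he).1]) hs.le
  obtain ⟨y, hy, hy'⟩ := Finset.exists_le_card_fiber_of_nsmul_le_card_of_maps_to
    (s := L) (t := Finset.range N) (f := fun e => ⌊(D e - a) / s⌋₊) (b := (L.card : ℝ) / N)
    (fun e he => by
      rw [Finset.mem_range, Nat.floor_lt (h0 e he), div_lt_iff₀ hs]
      linarith [(h e he).2])
    ⟨0, Finset.mem_range.2 hN⟩ (by
      rw [Finset.card_range, nsmul_eq_mul, mul_div_cancel₀ _ hN'.ne'])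
  refine ⟨y, Finset.mem_range.1 hy, _, Finset.filter_subset _ _, hy', fun e he => ?_⟩
  obtain ⟨he, hey⟩ := Finset.mem_filter.1 he
  have := (Nat.floor_eq_iff (h0 e he)).1 hey
  rw [le_div_iff₀ hs, div_lt_iff₀ hs] at this
  constructor <;> linarith

/-! ### The graph on the integer points. -/

section Graph

variable (d : Plane → Plane → ℝ)

/-- The graph on the integer points of the plane, two points being adjacent if their distance
is at most `1`. -/
def unitGraph (hd : ∀ x y, d x y = d y x) : SimpleGraph (ℤ × ℤ) where
  Adj p q := p ≠ q ∧ d (intPoint p) (intPoint q) ≤ 1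
  symm := ⟨fun p q h => ⟨h.1.symm, by rw [hd]; exact h.2⟩⟩
  loopless := ⟨fun p h => h.1 rfl⟩

theorem exists_walk_line {G : SimpleGraph (ℤ × ℤ)} {u : ℤ × ℤ} (hG : ∀ p, G.Adj p (p + u)) (n : ℕ)
    (p : ℤ × ℤ) : ∃ w : G.Walk p (p + n • u), w.length = n := by
  induction n generalizing p with
  | zero => exact ⟨SimpleGraph.Walk.nil.copy rfl (by simp), by simp⟩
  | succ n ih =>
    obtain ⟨w, hw⟩ := ih (p + u)
    refine ⟨(SimpleGraph.Walk.cons (hG p) w).copy rfl (by rw [succ_nsmul']; abel), ?_⟩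
    simp [hw]

theorem exists_walk_length_le {G : SimpleGraph (ℤ × ℤ)}
    (hG : ∀ p u : ℤ × ℤ, |u.1| + |u.2| = 1 → G.Adj p (p + u)) (p q : ℤ × ℤ) :
    ∃ w : G.Walk p q, (w.length : ℤ) = |q.1 - p.1| + |q.2 - p.2| := by
  have hsign : ∀ a : ℤ, ∃ s : ℤ, |s| = 1 ∧ a.natAbs • s = a := fun a => by
    rcases Int.natAbs_eq a with h | h
    · exact ⟨1, by simp, by rw [nsmul_eq_mul, mul_one]; exact h.symm⟩
    · exact ⟨-1, by simp, by rw [nsmul_eq_mul, mul_neg_one]; exact h.symm⟩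
  obtain ⟨s, hs, hs'⟩ := hsign (q.1 - p.1)
  obtain ⟨t, ht, ht'⟩ := hsign (q.2 - p.2)
  obtain ⟨w, hw⟩ := exists_walk_line (u := (s, 0)) (fun p => hG p _ (by simp [hs]))
    (q.1 - p.1).natAbs p
  obtain ⟨w', hw'⟩ := exists_walk_line (u := (0, t)) (fun p => hG p _ (by simp [ht]))
    (q.2 - p.2).natAbs (p + (q.1 - p.1).natAbs • (s, 0))
  refine ⟨(w.append w').copy rfl ?_, ?_⟩
  · ext
    · simp only [Prod.fst_add, Prod.smul_fst, hs', smul_zero]; ring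
    · simp only [Prod.snd_add, Prod.smul_snd, ht', smul_zero]; ring
  · simp [hw, hw']

theorem gridGraph_adj (p u : ℤ × ℤ) (hu : |u.1| + |u.2| = 1) : gridGraph.Adj p (p + u) := by
  have hu0 : u ≠ 0 := by rintro rfl; simp at hu
  rw [gridGraph, SimpleGraph.addCayley_adj']
  refine ⟨by simpa using hu0, ?_⟩
  obtain ⟨a, b⟩ := u
  simp only at hu
  have h : (a = 1 ∧ b = 0) ∨ (a = -1 ∧ b = 0) ∨ (a = 0 ∧ b = 1) ∨ (a = 0 ∧ b = -1) := by
    rcases abs_cases a with ⟨h1, h2⟩ | ⟨h1, h2⟩ <;> rcases abs_cases b with ⟨h3, h4⟩ | ⟨h3, h4⟩ <;>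
      omega
  rcases h with ⟨rfl, rfl⟩ | ⟨rfl, rfl⟩ | ⟨rfl, rfl⟩ | ⟨rfl, rfl⟩
  · exact ⟨(1, 0), by simp, by simp⟩
  · exact ⟨(1, 0), by simp, Or.inr (by ext <;> simp)⟩
  · exact ⟨(0, 1), by simp, by simp⟩
  · exact ⟨(0, 1), by simp, Or.inr (by ext <;> simp)⟩

theorem gridGraph_dist_le (p q : ℤ × ℤ) :
    (gridGraph.dist p q : ℝ) ≤ |(q.1 : ℝ) - p.1| + |(q.2 : ℝ) - p.2| := by
  obtain ⟨w, hw⟩ := exists_walk_length_le gridGraph_adj p q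
  have h1 : (gridGraph.dist p q : ℤ) ≤ |q.1 - p.1| + |q.2 - p.2| := by
    rw [← hw]; exact_mod_cast SimpleGraph.dist_le w
  exact_mod_cast h1

theorem gridGraph_connected : gridGraph.Connected :=
  ⟨fun p q => ⟨(exists_walk_length_le gridGraph_adj p q).choose⟩⟩

theorem abs_sub_le_norm_intPoint (p q : ℤ × ℤ) :
    |(q.1 : ℝ) - p.1| ≤ ‖intPoint q - intPoint p‖ ∧ |(q.2 : ℝ) - p.2| ≤ ‖intPoint q - intPoint p‖ := by
  constructor
  · simpa [intPoint] using PiLp.norm_apply_le (intPoint q - intPoint p) 0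
  · simpa [intPoint] using PiLp.norm_apply_le (intPoint q - intPoint p) 1

variable {d}

theorem unitGraph_adj (hup : ∀ x y, d x y ≤ ‖y - x‖) (hsymm : ∀ x y, d x y = d y x) (p u : ℤ × ℤ)
    (hu : |u.1| + |u.2| = 1) : (unitGraph d hsymm).Adj p (p + u) := by
  refine ⟨?_, dist_le_of_unit hup p u hu⟩
  rintro h
  obtain rfl : u = 0 := by simpa using h
  simp at hu

theorem unitGraph_connected (hup : ∀ x y, d x y ≤ ‖y - x‖) (hsymm : ∀ x y, d x y = d y x) :
    (unitGraph d hsymm).Connected :=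
  ⟨fun p q => ⟨(exists_walk_length_le (unitGraph_adj hup hsymm) p q).choose⟩⟩

/-- Every edge has `d`-length at most 1, so the calibration bound passes to the graph. -/
theorem le_unitGraph_dist (hup : ∀ x y, d x y ≤ ‖y - x‖) (hsymm : ∀ x y, d x y = d y x)
    (htri : ∀ x y z, d x z ≤ d x y + d y z) (p q : ℤ × ℤ) :
    d (intPoint p) (intPoint q) ≤ graphDist (unitGraph d hsymm) p q := by
  have hwalk : ∀ {p q : ℤ × ℤ} (w : (unitGraph d hsymm).Walk p q),
      d (intPoint p) (intPoint q) ≤ w.length := by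
    intro p q w
    induction w with
    | @nil u => simpa using hup (intPoint u) (intPoint u)
    | cons h w ih =>
      rw [SimpleGraph.Walk.length_cons]
      push_cast
      exact (htri _ _ _).trans (by linarith [h.2])
  obtain ⟨w, hw⟩ := (unitGraph_connected hup hsymm).exists_walk_length_eq_dist p q
  rw [graphDist, ← hw]
  exact hwalk w

theorem unitGraph_dist_le_one (hsymm : ∀ x y, d x y = d y x) {p q : ℤ × ℤ}
    (h : d (intPoint p) (intPoint q) ≤ 1) : graphDist (unitGraph d hsymm) p q ≤ 1 := by
  unfold graphDist
  by_cases hpq : p = q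
  · subst hpq; simp
  · have h1 : (unitGraph d hsymm).Adj p q := ⟨hpq, h⟩
    rw [SimpleGraph.dist_eq_one_iff_adj.2 h1]; simp

theorem unitGraph_dist_triangle (hup : ∀ x y, d x y ≤ ‖y - x‖) (hsymm : ∀ x y, d x y = d y x)
    (x y z : ℤ × ℤ) : graphDist (unitGraph d hsymm) x z ≤
      graphDist (unitGraph d hsymm) x y + graphDist (unitGraph d hsymm) y z := by
  unfold graphDist
  exact_mod_cast (unitGraph_connected hup hsymm).dist_triangle

theorem unitGraph_hasBoundedDegree (hlow : ∀ x y, 1 / 256 * ‖y - x‖ ≤ d x y)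
    (hsymm : ∀ x y, d x y = d y x) : HasBoundedDegree (unitGraph d hsymm) := by
  classical
  have hbox : ∀ a : ℤ, ∃ B : Finset (ℤ × ℤ), ∀ u : ℤ × ℤ, |u.1| ≤ a → |u.2| ≤ a → u ∈ B := fun a =>
    ⟨Finset.Icc (-a) a ×ˢ Finset.Icc (-a) a, fun u h1 h2 => Finset.mem_product.2
      ⟨Finset.mem_Icc.2 (abs_le.1 h1), Finset.mem_Icc.2 (abs_le.1 h2)⟩⟩
  obtain ⟨B, hB⟩ := hbox 256
  refine ⟨B.card, fun p => ?_⟩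
  have hsub : (unitGraph d hsymm).neighborSet p ⊆ (B.image fun u => p + u : Finset (ℤ × ℤ)) := by
    intro q hq
    have h1 : d (intPoint p) (intPoint q) ≤ 1 := hq.2
    have h2 := hlow (intPoint p) (intPoint q)
    obtain ⟨h3, h4⟩ := abs_sub_le_norm_intPoint p q
    have h5 : |q.1 - p.1| ≤ 256 := by
      have : |(q.1 : ℝ) - p.1| ≤ 256 := by linarith
      exact_mod_cast this
    have h6 : |q.2 - p.2| ≤ 256 := by
      have : |(q.2 : ℝ) - p.2| ≤ 256 := by linarith
      exact_mod_cast this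
    simp only [Finset.coe_image, mem_image, Finset.mem_coe]
    exact ⟨q - p, hB _ h5 h6, by abel⟩
  calc _ ≤ ((B.image fun u => p + u : Finset (ℤ × ℤ)) : Set (ℤ × ℤ)).encard := encard_le_encard hsub
    _ ≤ _ := by
      rw [encard_coe_eq_coe_finsetCard]
      exact_mod_cast Finset.card_image_le

theorem unitGraph_isQuasiIsometry (hlow : ∀ x y, 1 / 256 * ‖y - x‖ ≤ d x y)
    (hup : ∀ x y, d x y ≤ ‖y - x‖) (hsymm : ∀ x y, d x y = d y x)
    (htri : ∀ x y z, d x z ≤ d x y + d y z) :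
    IsQuasiIsometry (graphDist (unitGraph d hsymm)) (graphDist gridGraph) id := by
  -- The constant 512 is 256 times the factor 2 between the ℓ¹ and Euclidean norms.
  refine ⟨⟨1, one_pos, fun y => ⟨y, by simp [graphDist]⟩⟩, 512, by norm_num, fun p q => ?_⟩
  have h1 : graphDist (unitGraph d hsymm) p q ≤ graphDist gridGraph p q := by
    obtain ⟨w, hw⟩ := gridGraph_connected.exists_walk_length_eq_dist p q
    have hle : gridGraph ≤ unitGraph d hsymm := by
      rw [gridGraph, SimpleGraph.addCayley_le_iff]
      rintro g hg a -
      refine (unitGraph_adj hup hsymm a g ?_).symm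
      rcases hg with rfl | rfl <;> simp
    have := SimpleGraph.dist_le (w.mapLe hle)
    rw [SimpleGraph.Walk.length_map, hw] at this
    unfold graphDist
    exact_mod_cast this
  have h2 : graphDist gridGraph p q ≤ 512 * graphDist (unitGraph d hsymm) p q := by
    have h3 := gridGraph_dist_le p q
    have h4 := abs_sub_le_norm_intPoint p q
    have h5 := hlow (intPoint p) (intPoint q)
    have h6 := le_unitGraph_dist hup hsymm htri p q
    unfold graphDist at h6 ⊢
    linarith [h4.1, h4.2]
  have h0 : 0 ≤ graphDist (unitGraph d hsymm) p q := Nat.cast_nonneg _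
  simp only [id_eq]
  constructor <;> linarith

/-- On a fast line points 256 apart are equal or adjacent; the remainder costs at most one more
edge. -/
theorem unitGraph_dist_le_of_line (hup : ∀ x y, d x y ≤ ‖y - x‖) (hsymm : ∀ x y, d x y = d y x)
    (p u : ℤ × ℤ) (n : ℕ)
    (h : ∀ i j : ℕ, i + j ≤ n → d (intPoint (p + i • u)) (intPoint (p + (i + j) • u)) ≤ j / 256) :
    graphDist (unitGraph d hsymm) p (p + n • u) ≤ n / 256 + 1 := by
  have key : ∀ i : ℕ, 256 * i ≤ n → graphDist (unitGraph d hsymm) p (p + (256 * i) • u) ≤ i := by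
    intro i
    induction i with
    | zero => intro _; simp [graphDist]
    | succ i ih =>
      intro hi
      have h1 := ih (by omega)
      have h2 := h (256 * i) 256 (by omega)
      have h3 := unitGraph_dist_le_one hsymm (h2.trans (by norm_num))
      rw [show 256 * i + 256 = 256 * (i + 1) by ring] at h3
      have := unitGraph_dist_triangle hup hsymm p (p + (256 * i) • u) (p + (256 * (i + 1)) • u)
      push_cast
      linarith
  have h1 := key (n / 256) (by omega)
  have h2 := h (256 * (n / 256)) (n % 256) (by omega)
  rw [Nat.div_add_mod] at h2
  have h3 : ((n % 256 : ℕ) : ℝ) ≤ 256 := by exact_mod_cast (Nat.mod_lt n (by norm_num)).le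
  have h4 := unitGraph_dist_le_one hsymm (h2.trans (by linarith))
  have h5 := unitGraph_dist_triangle hup hsymm p (p + (256 * (n / 256)) • u) (p + n • u)
  have h6 : ((n / 256 : ℕ) : ℝ) ≤ n / 256 := by exact_mod_cast Nat.cast_div_le (α := ℝ)
  linarith

end Graph

/-! ### Large spheres around the roots. -/

theorem le_norm_intPoint_sub {p q : ℤ × ℤ} (h : p ≠ q) : 1 ≤ ‖intPoint q - intPoint p‖ := by
  obtain ⟨h1, h2⟩ := abs_sub_le_norm_intPoint p q
  by_cases h3 : q.1 = p.1
  · have h4 : q.2 - p.2 ≠ 0 := fun h4 => h (Prod.ext h3.symm (by linarith))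
    have h5 : (1 : ℝ) ≤ |(q.2 : ℝ) - p.2| := by exact_mod_cast Int.one_le_abs h4
    linarith
  · have h5 : (1 : ℝ) ≤ |(q.1 : ℝ) - p.1| := by exact_mod_cast Int.one_le_abs (sub_ne_zero.2 h3)
    linarith

theorem disjoint_ball_intPoint {p q : ℤ × ℤ} (h : p ≠ q) :
    Disjoint (Metric.ball (intPoint p) (1 / 4)) (Metric.ball (intPoint q) (1 / 4)) := by
  apply Metric.ball_disjoint_ball
  rw [dist_comm, dist_eq_norm]
  linarith [le_norm_intPoint_sub h]

theorem volume_biUnion_ball (F : Finset (ℤ × ℤ)) (c : ℤ) :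
    (volume : Measure Plane) (⋃ e ∈ F, Metric.ball (intPoint (e + (c, 0))) (1 / 4)) =
      F.card * (volume : Measure Plane) (Metric.ball 0 (1 / 4)) := by
  rw [measure_biUnion_finset _ fun _ _ => Metric.isOpen_ball.measurableSet]
  · rw [Finset.sum_congr rfl fun e _ => Measure.addHaar_ball_center volume (intPoint (e + (c, 0))) _]
    simp
  · intro p _ q _ h
    exact disjoint_ball_intPoint fun h' => h (add_right_cancel h')

/-- The spheres of the unit graph around the roots of the trees are large. -/
theorem exists_large_sphere_unitGraph {d : Plane → Plane → ℝ} (hup : ∀ x y, d x y ≤ ‖y - x‖)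
    (hsymm : ∀ x y, d x y = d y x) (htri : ∀ x y z, d x z ≤ d x y + d y z) {m : ℕ} {c : ℤ}
    (hleaf : ∀ e ∈ treeLeaves (2 * m), totalTime (2 * m + 1) ≤
      d (intPoint (e + (c, 0))) (intPoint (treeRoot (2 * m) + (c, 0))))
    (hfast : ∀ p u : ℤ × ℤ, |u.1| + |u.2| = 1 → ∀ n : ℕ,
      (∀ t ∈ Icc (0 : ℝ) n, ((p.1 + t * u.1, p.2 + t * u.2) : ℝ × ℝ) ∈ treeCore (2 * m)) →
      d (intPoint (p + (c, 0))) (intPoint (p + n • u + (c, 0))) ≤ n / 256) :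
    ∃ (x : ℤ × ℤ) (r : ℝ), totalTime (2 * m + 1) - 1 ≤ r ∧ r ≤ totalTime (2 * m + 1) + 4 * m + 4 ∧
      ENNReal.ofReal (1 * (4 ^ m / (16 * m + 16))) ≤
        countingVolume (thickSphere (graphDist (unitGraph d hsymm)) x r) := by
  set G := unitGraph d hsymm with hG
  set x : ℤ × ℤ := treeRoot (2 * m) + (c, 0) with hx
  have hD : ∀ e ∈ treeLeaves (2 * m), graphDist G (e + (c, 0)) x ≤
      totalTime (2 * m + 1) + 2 * ((2 * m : ℕ) + 1) := fun e he => by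
    refine leaf_root_le (2 * m) (fun p q => graphDist G (p + (c, 0)) (q + (c, 0)))
      (fun _ _ _ => unitGraph_dist_triangle hup hsymm _ _ _) (fun p u hu => ?_)
      (fun p u hu n h => ?_) he
    · refine unitGraph_dist_le_one hsymm ?_
      rw [add_right_comm]
      exact dist_le_of_unit hup _ u hu
    · rw [add_right_comm]
      refine unitGraph_dist_le_of_line hup hsymm _ u n fun i j hij => ?_
      have := hfast (p + i • u) u hu j fun t ht => ?_
      · rw [add_right_comm p (c, 0) (i • u), add_right_comm p (c, 0) ((i + j) • u)]
        rwa [show p + i • u + j • u = p + (i + j) • u by rw [add_smul, add_assoc]] at this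
      · have h1 := h (i + t) ⟨by linarith [ht.1, (Nat.cast_nonneg i : (0 : ℝ) ≤ i)], by
          have : (i : ℝ) + j ≤ n := by exact_mod_cast hij
          linarith [ht.2]⟩
        convert h1 using 1
        have hi : ((i • u).1 : ℝ) = i * u.1 ∧ ((i • u).2 : ℝ) = i * u.2 := by simp
        simp only [Prod.fst_add, Prod.snd_add, Prod.mk.injEq]
        push_cast [hi.1, hi.2]
        constructor <;> ring
  -- The excess over the total time is at most `4 * m + 2`, so `4 * m + 4` unit windows cover it
  -- even though they are half-open.
  obtain ⟨y, hy, F, hFL, hFc, hF⟩ := exists_window (treeLeaves (2 * m))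
    (fun e => graphDist G x (e + (c, 0))) (totalTime (2 * m + 1)) 1 one_pos (4 * m + 4) (by omega)
    fun e he => by
      have h1 := (hleaf e he).trans (le_unitGraph_dist hup hsymm htri _ _)
      have h2 := hD e he
      have h3 : graphDist G x (e + (c, 0)) = graphDist G (e + (c, 0)) x := by
        simp only [graphDist, SimpleGraph.dist_comm]
      rw [h3]
      refine ⟨h1, ?_⟩
      push_cast at h2 ⊢
      linarith
  have hy' : (y : ℝ) ≤ 4 * m + 4 := by exact_mod_cast hy.le
  refine ⟨x, totalTime (2 * m + 1) + y, by linarith [(Nat.cast_nonneg y : (0 : ℝ) ≤ y)],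
    by linarith, ?_⟩
  have hsub : ((F.image fun e => e + (c, 0) : Finset (ℤ × ℤ)) : Set (ℤ × ℤ)) ⊆
      thickSphere (graphDist G) x (totalTime (2 * m + 1) + y) := by
    intro z hz
    simp only [Finset.coe_image, mem_image, Finset.mem_coe] at hz
    obtain ⟨e, he, rfl⟩ := hz
    have := hF e he
    refine ⟨?_, ?_⟩
    · change graphDist G x (e + (c, 0)) < _
      linarith
    · change ¬ graphDist G x (e + (c, 0)) < _
      linarith
  have hcard : (F.image fun e => e + (c, 0) : Finset (ℤ × ℤ)).card = F.card :=
    Finset.card_image_of_injective _ (add_left_injective _)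
  have h4 : (4 : ℝ) ^ m / (16 * m + 16) ≤ F.card := by
    refine le_trans ?_ hFc
    rw [card_treeLeaves, pow_mul]
    push_cast
    gcongr <;> norm_num
  calc _ ≤ ENNReal.ofReal F.card := ENNReal.ofReal_le_ofReal (by linarith)
    _ = (F.card : ℝ≥0∞) := ENNReal.ofReal_natCast _
    _ = countingVolume ((F.image fun e => e + (c, 0) : Finset (ℤ × ℤ)) : Set (ℤ × ℤ)) := by
      rw [countingVolume, encard_coe_eq_coe_finsetCard, hcard]; simp
    _ ≤ _ := by
      unfold countingVolume
      exact_mod_cast encard_le_encard hsub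

/-- The metric spheres around the roots of the trees are large. -/
theorem exists_large_sphere {d : Plane → Plane → ℝ} (hup : ∀ x y, d x y ≤ ‖y - x‖)
    (hsymm : ∀ x y, d x y = d y x) (htri : ∀ x y z, d x z ≤ d x y + d y z) {m : ℕ} {c : ℤ}
    (hleaf : ∀ e ∈ treeLeaves (2 * m), totalTime (2 * m + 1) ≤
      d (intPoint (e + (c, 0))) (intPoint (treeRoot (2 * m) + (c, 0))))
    (hfast : ∀ p u : ℤ × ℤ, |u.1| + |u.2| = 1 → ∀ n : ℕ,
      (∀ t ∈ Icc (0 : ℝ) n, ((p.1 + t * u.1, p.2 + t * u.2) : ℝ × ℝ) ∈ treeCore (2 * m)) →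
      d (intPoint (p + (c, 0))) (intPoint (p + n • u + (c, 0))) ≤ n / 256) :
    ∃ (x : Plane) (r : ℝ), totalTime (2 * m + 1) - 1 ≤ r ∧
      r ≤ totalTime (2 * m + 1) + 4 * m + 4 ∧ ∃ s : Set Plane, MeasurableSet s ∧
      s ⊆ thickSphere d x r ∧
      ENNReal.ofReal (4 ^ m / (16 * m + 16)) * volume (Metric.ball (0 : Plane) (1 / 4)) ≤
        volume s := by
  set x : Plane := intPoint (treeRoot (2 * m) + (c, 0)) with hx
  have hD : ∀ e ∈ treeLeaves (2 * m), d (intPoint (e + (c, 0))) x ≤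
      totalTime (2 * m + 1) + 2 * ((2 * m : ℕ) + 1) := fun e he => by
    refine leaf_root_le (2 * m) (fun p q => d (intPoint (p + (c, 0))) (intPoint (q + (c, 0))))
      (fun _ _ _ => htri _ _ _) (fun p u hu => ?_) (fun p u hu n h => ?_) he
    · rw [add_right_comm]
      exact dist_le_of_unit hup _ u hu
    · exact (hfast p u hu n h).trans (by linarith)
  -- Windows have width 1/2 so that, enlarged by the radius 1/4 of the balls on both sides, they
  -- fill exactly one sphere of thickness 1.
  obtain ⟨y, hy, F, hFL, hFc, hF⟩ := exists_window (treeLeaves (2 * m))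
    (fun e => d x (intPoint (e + (c, 0)))) (totalTime (2 * m + 1)) (1 / 2) (by norm_num)
    (8 * m + 8) (by omega) fun e he => by
      have h2 := hD e he
      rw [hsymm x]
      refine ⟨hleaf e he, ?_⟩
      push_cast at h2 ⊢
      linarith
  have hy' : (y : ℝ) ≤ 8 * m + 8 := by exact_mod_cast hy.le
  refine ⟨x, totalTime (2 * m + 1) + 1 / 2 * y - 1 / 4,
    by linarith [(Nat.cast_nonneg y : (0 : ℝ) ≤ y)], by linarith,
    ⋃ e ∈ F, Metric.ball (intPoint (e + (c, 0))) (1 / 4),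
    F.measurableSet_biUnion fun _ _ => Metric.isOpen_ball.measurableSet, ?_, ?_⟩
  · refine iUnion₂_subset fun e he z hz => ?_
    rw [mem_ball_iff_norm] at hz
    have h1 := hF e he
    have h2 := htri x (intPoint (e + (c, 0))) z
    have h3 := htri x z (intPoint (e + (c, 0)))
    have h4 := hup (intPoint (e + (c, 0))) z
    rw [hsymm z] at h3
    refine ⟨?_, ?_⟩
    · change d x z < _
      linarith
    · change ¬ d x z < _
      linarith
  · rw [volume_biUnion_ball]
    gcongr
    rw [← ENNReal.ofReal_natCast]
    refine ENNReal.ofReal_le_ofReal (le_trans ?_ hFc)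
    rw [card_treeLeaves, pow_mul]
    push_cast
    gcongr <;> norm_num

end

theorem mainTheorem4 :
    (∃ (V : Type) (G : SimpleGraph V),
      G.Connected ∧ HasBoundedDegree G ∧
      (∃ f : V → ℤ × ℤ, IsQuasiIsometry (graphDist G) (graphDist gridGraph) f) ∧
      ¬ SpheresDominatedBy (graphDist G) countingVolume
          (fun r : ℝ => r ^ (Real.log 3 / Real.log 2))) ∧
    (∃ (M : Type) (_ : MetricSpace M) (_ : MeasurableSpace M) (_ : BorelSpace M)
      (_ : ChartedSpace (EuclideanSpace ℝ (Fin 2)) M) (_ : IsManifold (𝓡 2) ∞ M)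
      (_ : Bundle.RiemannianBundle (fun x : M => TangentSpace (𝓡 2) x))
      (_ : IsContMDiffRiemannianBundle (𝓡 2) ∞ (EuclideanSpace ℝ (Fin 2))
        (fun x : M => TangentSpace (𝓡 2) x))
      (_ : IsRiemannianManifold (𝓡 2) M) (μ : MeasureTheory.Measure M),
      IsRiemannianMeasure (n := 2) μ ∧
      (∃ f : M → EuclideanSpace ℝ (Fin 2), IsBiLipschitz f) ∧
      ¬ SpheresDominatedBy (fun x y : M => dist x y) (fun S : Set M => μ S)
          (fun r : ℝ => r ^ (Real.log 3 / Real.log 2))) := by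
  obtain ⟨ρ, c, hρ, hρ0, hρ1, hcore, hlip⟩ := exists_conformal_factor
  obtain ⟨d, hlow, hup, hsymm, htri, hv, hseg, M, i1, i2, i3, i4, i5, i6, i7, i8, μ, φ, hμ, hd, hvol⟩ :=
    exists_conformal_plane ρ hρ (by norm_num : (0 : ℝ) < 1 / 256) hρ0 hρ1
  have hleaf := fun k => @le_dist_leaf_root ρ k (c k) d (hlip k) hv
  have hfast := fun k => @dist_le_of_treeCore ρ k (c k) d (hcore k) hseg
  refine ⟨⟨ℤ × ℤ, unitGraph d hsymm, unitGraph_connected hup hsymm,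
    unitGraph_hasBoundedDegree hlow hsymm, ⟨id, unitGraph_isQuasiIsometry hlow hup hsymm htri⟩,
    not_spheresDominatedBy _ _ one_pos fun m => exists_large_sphere_unitGraph hup hsymm htri
      (fun e he => hleaf (2 * m) he) (hfast (2 * m))⟩,
    ⟨M, i1, i2, i3, i4, i5, i6, i7, i8, μ, hμ, ⟨φ, φ.bijective, 256, by norm_num, fun x y => ?_⟩, ?_⟩⟩
  · have h1 := hlow (φ x) (φ y)
    have h2 := hup (φ x) (φ y)
    rw [dist_comm (φ x), dist_eq_norm, hd]
    constructor
    · have : 0 ≤ d (φ x) (φ y) := le_trans (by positivity) h1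
      linarith
    · linarith
  · have hv0 : volume (Metric.ball (0 : Plane) (1 / 4)) ≠ ⊤ := measure_ball_lt_top.ne
    have hv1 : 0 < (volume (Metric.ball (0 : Plane) (1 / 4))).toReal :=
      ENNReal.toReal_pos (Metric.measure_ball_pos volume _ (by norm_num)).ne' hv0
    refine not_spheresDominatedBy _ _
      (κ := (1 / 256) ^ 2 * (volume (Metric.ball (0 : Plane) (1 / 4))).toReal) (by positivity)
      fun m => ?_
    obtain ⟨x, r, hr1, hr2, s, hs, hsub, hle⟩ := exists_large_sphere hup hsymm htri
      (fun e he => hleaf (2 * m) he) (hfast (2 * m))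
    refine ⟨φ.symm x, r, hr1, hr2, ?_⟩
    have hpre : φ ⁻¹' s ⊆ thickSphere (fun x y : M => dist x y) (φ.symm x) r := by
      intro z hz
      have := hsub hz
      simpa [thickSphere, openBall, hd] using this
    refine le_trans ?_ ((hvol s hs).trans (measure_mono hpre))
    calc _ = ENNReal.ofReal ((1 / 256) ^ 2) * (ENNReal.ofReal (4 ^ m / (16 * m + 16)) *
          volume (Metric.ball (0 : Plane) (1 / 4))) := by
          rw [mul_assoc, ENNReal.ofReal_mul (by positivity), ENNReal.ofReal_mul (by positivity),
            ENNReal.ofReal_toReal hv0, mul_comm (volume _)]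
      _ ≤ _ := by gcongr
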